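/- **Conventions.** All operads below are operads in $\mathbf{Cat}$ with its cartesian product, and all their laws hold strictly. An *$n$-tree* is a chain of order preserving maps of finite ordinals $T=([k_n]\to[k_{n-1}]\to\dots\to[k_0])$, where $[k]$ is the ordinal with $k\ge 0$ elements and $k_0=1$; $|T|=k_n$ is its number of tips. A morphism $\sigma:T\to S$ of $n$-trees is a family of maps commuting with the structure maps and order preserving on each fibre of the structure maps. This is the category $\Omega_n$; its terminal object is the tree $U_n$ with one vertex in each level. For a tip $i$ of $S$ the fibre $\sigma^{-1}(i)$ is the tree of all vertices that $\sigma$ maps to the branch of $S$ ending in $i$. A *categorical $n$-operad* $A$ consists of categories $A_T$ ($T\in\Omega_n$), an object $e\in A_{U_n}$ and functors $m_\sigma:A_S\times A_{T_1}\times\dots\times A_{T_k}\to A_T$ for every $\sigma:T\to S$ with list of fibres $T_1,\dots,T_k$ over the $k=|S|$ tips of $S$, associative for composites $T\to S\to R$ and unital. With operadic functors and operadic natural transformations they form a $2$-category $\mathbf{CO}_n$. An *internal $n$-operad* in $A$ consists of objects $a_T\in A_T$ and morphisms $\mu_\sigma:m_\sigma(a_S;a_{T_1},\dots,a_{T_k})\to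 a_T$ and $\epsilon:e\to a_{U_n}$ satisfying the associativity and unit conditions; with the evident morphisms these form a category $IO_n(A)$, and $IO_n:\mathbf{CO}_n\to\mathbf{Cat}$ is a $2$-functor. A *(left) symmetric categorical operad* $A$ consists of categories $A_n$ ($n\ge 0$), an object $e\in A_1$, functors $m:A_k\times A_{n_1}\times\dots\times A_{n_k}\to A_{n_1+\dots+n_k}$, associative and unital, and left actions of the symmetric groups on the $A_n$, equivariant with respect to block permutations and to permutations within blocks. With operadic functors commuting with the actions, and operadic natural transformations compatible with the actions, they form a $2$-category $\mathbf{SCO}$. Every map $\sigma:[n]\to[k]$ of finite ordinals is uniquely a bijection $\pi(\sigma)$ that preserves the order on the fibres of $\sigma$, followed by an order preserving map; put $m_\sigma=\pi(\sigma)^{-1}\circ m:A_k\times A_{n_1}\times\dots\times A_{n_k}\to A_n$, where $n_i$ is the cardinality of $\sigma^{-1}(i)$. An *internal symmetric operad* in $A$ consists of objects $a_n\in A_n$ and morphisms $\mu_\sigma:m_\sigma(a_k;a_{n_1},\dots,a_{n_k})\to a_n$ for all maps $\sigma:[n]\to[k]$ and $\epsilon:e\to a_1$, satisfying associativity and unit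 conditions; these form a category $IO^{sym}_\infty(A)$. For $1\le n<\infty$ an *internal $n$-operad* in $A$ is an internal $n$-operad in the categorical $n$-operad $Des_n(A)$ with $Des_n(A)_T=A_{|T|}$, with the unit of $A$, and with multiplications $m_{|\sigma|}$, where $|\sigma|$ is the map of tips induced by $\sigma$; they form the category $IO^{sym}_n(A)=IO_n(Des_n(A))$. So there are $2$-functors $IO^{sym}_n:\mathbf{SCO}\to\mathbf{Cat}$ for $1\le n\le\infty$. The *internal desymmetrisation* $\delta_n:IO^{sym}_\infty(A)\to IO^{sym}_n(A)$ is $(\delta_n b)_T=b_{|T|}$, $(\delta_n b)_\sigma=\mu_{|\sigma|}$; $\delta_\infty$ is the identity. A $2$-functor $G:\mathcal B\to\mathbf{Cat}$ is *represented* by an object $H$ if there are isomorphisms of categories $\mathcal B(H,A)\cong G(A)$ that are $2$-natural in $A$. **Theorem.** 1. For every $1\le n<\infty$ there is a categorical $n$-operad $\mathbf H^n$ representing $IO_n:\mathbf{CO}_n\to\mathbf{Cat}$. 2. There is a symmetric categorical operad $\mathbf H^\infty$ representing $IO^{sym}_\infty:\mathbf{SCO}\to\mathbf{Cat}$. 3.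 For every $1\le n\le\infty$ there is a symmetric categorical operad $\mathbf h^n$ representing $IO^{sym}_n:\mathbf{SCO}\to\mathbf{Cat}$. 4. Let $1\le n\le\infty$, and let $\zeta:\mathbf h^n\to\mathbf H^\infty$ be the morphism that corresponds to $\delta_n(u)$, where $u\in IO^{sym}_\infty(\mathbf H^\infty)$ corresponds to the identity of $\mathbf H^\infty$. Let $A$ be a symmetric categorical operad for which $\delta_n:IO^{sym}_\infty(A)\to IO^{sym}_n(A)$ has a left adjoint $sym_n$. Then for every $a\in IO^{sym}_n(A)$, with representing morphism $\tilde a:\mathbf h^n\to A$, the morphism $\mathbf H^\infty\to A$ that represents $sym_n(a)$ is a left Kan extension of $\tilde a$ along $\zeta$ in the $2$-category $\mathbf{SCO}$; its universal $2$-cell $\tilde a\Rightarrow\widetilde{sym_n(a)}\circ\zeta$ corresponds to the unit $a\to\delta_n\,sym_n(a)$ of the adjunction. -/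

import Mathlib

open CategoryTheory

universe v u

namespace HigherOperad

/-- A category whose morphisms have fibres: every object `T` has a finite ordered set of tips
`Fin (card T)`, every morphism `σ : T ⟶ S` induces a map of tips, and `IsFibre σ i ι` says that
`ι : F ⟶ T` is the inclusion of the fibre of `σ` over the tip `i` of `S`; `pt` is the terminal
object. It is a device for stating the definition of an operad once and for all; only the three
instances given below (`OmegaS`, `OmegaMono`, `NTree n`) are used. -/
class FibreCat (C : Type) extends Category.{0} C where
  card : C → ℕ
  tip : ∀ {T S : C}, (T ⟶ S) → Fin (card T) → Fin (card S)
  pt : C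
  IsFibre : ∀ {T S F : C}, (T ⟶ S) → Fin (card S) → (F ⟶ T) → Prop

open FibreCat

/-- The fibres of `σ : T ⟶ S` are the objects `F i`. In the three instances below the objects
are skeletal, so every `σ` has exactly one list of fibres `F`, with exactly one list of
inclusions. Quantifying over all `F` and `Fibres σ F` avoids transports along equalities. -/
structure Fibres {C : Type} [FibreCat C] {T S : C} (σ : T ⟶ S) (F : Fin (card S) → C) where
  incl : ∀ i, F i ⟶ T
  isFibre : ∀ i, IsFibre σ i (incl i)

/-- The functor with components `x` and `y i`, `E ⥤ X × ∏ i, Y i`. -/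
abbrev tuple {E X : Type*} [Category* E] [Category* X] {k : ℕ} {Y : Fin k → Type*}
    [∀ i, Category* (Y i)] (x : E ⥤ X) (y : ∀ i, E ⥤ Y i) : E ⥤ X × (∀ i, Y i) :=
  x.prod' (Functor.pi' y)

/-- A categorical operad (an operad in `Cat` with the cartesian product) over `C`: categories
`obj T`, a unit object in `obj pt`, and for each `σ : T ⟶ S` with fibres `F i` a functor
`mul σ : obj S × ∏ i, obj (F i) ⥤ obj T`. The laws are strict equalities of functors, written on
generalised elements, that is, functors from an arbitrary category `E`.

In `assoc`, for `T ⟶ S ⟶ R`, the `X i`, `Y i`, `Z j` are the fibres of `σ ≫ ω`, `ω`, `σ`, the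
`τ i : X i ⟶ Y i` are the morphisms of fibres induced by `σ`, and the fibres of `τ i` are fibres
of `σ`. For `C = NTree n` this is a categorical `n`-operad. -/
structure CatOperad (C : Type) [FibreCat C] where
  obj : C → Cat.{v, u}
  unit : obj pt
  mul : ∀ {T S : C} (σ : T ⟶ S) {F : Fin (card S) → C}, Fibres σ F →
    (obj S × (∀ i, obj (F i)) ⥤ obj T)
  assoc : ∀ {T S R : C} (σ : T ⟶ S) (ω : S ⟶ R) {X Y : Fin (card R) → C} {Z : Fin (card S) → C}
    (hX : Fibres (σ ≫ ω) X) (hY : Fibres ω Y) (hZ : Fibres σ Z)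
    (τ : ∀ i, X i ⟶ Y i) (_ : ∀ i, τ i ≫ hY.incl i = hX.incl i ≫ σ)
    (hW : ∀ i, Fibres (τ i) fun j => Z (tip (hY.incl i) j))
    (E : Cat.{v, u}) (a : E ⥤ obj R) (b : ∀ i, E ⥤ obj (Y i)) (c : ∀ j, E ⥤ obj (Z j)),
    tuple (tuple a b ⋙ mul ω hY) c ⋙ mul σ hZ =
      tuple a (fun i => tuple (b i) (fun j => c (tip (hY.incl i) j)) ⋙ mul (τ i) (hW i)) ⋙
        mul (σ ≫ ω) hX
  mul_id : ∀ {T : C} (hF : Fibres (𝟙 T) fun _ => pt) (E : Cat.{v, u}) (a : E ⥤ obj T),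
    tuple a (fun _ => (Functor.const E).obj unit) ⋙ mul (𝟙 T) hF = a
  id_mul : ∀ {T : C} (σ : T ⟶ pt) (hF : Fibres σ fun _ => T) (E : Cat.{v, u}) (a : E ⥤ obj T),
    tuple ((Functor.const E).obj unit) (fun _ => a) ⋙ mul σ hF = a

namespace CatOperad

variable {C : Type} [FibreCat C]

/-- Operadic functors: families of functors that preserve multiplication and unit strictly. -/
@[ext]
structure OpFunctor (A B : CatOperad.{v, u} C) where
  functor : ∀ T, A.obj T ⥤ B.obj T
  mul : ∀ {T S : C} (σ : T ⟶ S) {F : Fin (card S) → C} (hF : Fibres σ F),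
    A.mul σ hF ⋙ functor T =
      (functor S).prod (Functor.pi fun i => functor (F i)) ⋙ B.mul σ hF
  unit : (functor pt).obj A.unit = B.unit

theorem OpFunctor.mul_obj {A B : CatOperad.{v, u} C} (Φ : A.OpFunctor B) {T S : C} (σ : T ⟶ S)
    {F : Fin (card S) → C} (hF : Fibres σ F) (x : A.obj S) (y : ∀ i, A.obj (F i)) :
    (Φ.functor T).obj ((A.mul σ hF).obj (x, y)) =
      (B.mul σ hF).obj ((Φ.functor S).obj x, fun i => (Φ.functor (F i)).obj (y i)) :=
  Functor.congr_obj (Φ.mul σ hF) (x, y)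

/-- Operadic natural transformations: families of natural transformations compatible with
multiplication and unit. -/
@[ext]
structure OpTrans {A B : CatOperad.{v, u} C} (Φ Ψ : A.OpFunctor B) where
  app : ∀ T, Φ.functor T ⟶ Ψ.functor T
  mul : ∀ {T S : C} (σ : T ⟶ S) {F : Fin (card S) → C} (hF : Fibres σ F)
    (x : A.obj S) (y : ∀ i, A.obj (F i)),
    (app T).app ((A.mul σ hF).obj (x, y)) =
      eqToHom (Φ.mul_obj σ hF x y) ≫
        (B.mul σ hF).map (Prod.mkHom ((app S).app x) fun i => (app (F i)).app (y i)) ≫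
          eqToHom (Ψ.mul_obj σ hF x y).symm
  unit : (app pt).app A.unit = eqToHom (Φ.unit.trans Ψ.unit.symm)

instance homCategory (A B : CatOperad.{v, u} C) : Category (A.OpFunctor B) where
  Hom Φ Ψ := OpTrans Φ Ψ
  id Φ := ⟨fun T => 𝟙 _, fun σ F hF x y => by
    have : (Prod.mkHom (𝟙 ((Φ.functor _).obj x)) fun i => 𝟙 ((Φ.functor (F i)).obj (y i))) =
      𝟙 ((Φ.functor _).obj x, fun i => (Φ.functor (F i)).obj (y i)) := rfl
    simp [this], by simp⟩
  comp α β := ⟨fun T => α.app T ≫ β.app T, fun σ F hF x y => by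
    simp only [NatTrans.comp_app, α.mul, β.mul, Category.assoc, eqToHom_trans_assoc,
      eqToHom_refl, Category.id_comp]
    rw [← Functor.map_comp_assoc]; rfl, by simp [α.unit, β.unit]⟩
  id_comp α := by apply OpTrans.ext; funext T; exact Category.id_comp _
  comp_id α := by apply OpTrans.ext; funext T; exact Category.comp_id _
  assoc α β γ := by apply OpTrans.ext; funext T; exact Category.assoc _ _ _


@[ext]
theorem hom₂_ext {A B : CatOperad.{v, u} C} {Φ Ψ : A.OpFunctor B} {α β : Φ ⟶ Ψ}
    (h : ∀ T, α.app T = β.app T) : α = β :=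
  OpTrans.ext (funext h)

@[simp] theorem id_app {A B : CatOperad.{v, u} C} (Φ : A.OpFunctor B) (T : C) :
    OpTrans.app (𝟙 Φ) T = 𝟙 _ := rfl

@[simp] theorem comp_app {A B : CatOperad.{v, u} C} {Φ Ψ Θ : A.OpFunctor B} (α : Φ ⟶ Ψ)
    (β : Ψ ⟶ Θ) (T : C) : OpTrans.app (α ≫ β) T = α.app T ≫ β.app T := rfl

def OpFunctor.id (A : CatOperad.{v, u} C) : A.OpFunctor A :=
  ⟨fun _ => 𝟭 _, fun _ _ _ => rfl, rfl⟩

def OpFunctor.comp {A B D : CatOperad.{v, u} C} (Φ : A.OpFunctor B) (Ψ : B.OpFunctor D) :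
    A.OpFunctor D where
  functor T := Φ.functor T ⋙ Ψ.functor T
  mul σ F hF := by
    rw [← Functor.assoc, Φ.mul σ hF, Functor.assoc, Ψ.mul σ hF]; rfl
  unit := (congrArg (Ψ.functor pt).obj Φ.unit).trans Ψ.unit

theorem OpFunctor.mul_map {A B : CatOperad.{v, u} C} (Φ : A.OpFunctor B) {T S : C} (σ : T ⟶ S)
    {F : Fin (card S) → C} (hF : Fibres σ F) {x x' : A.obj S} {y y' : ∀ i, A.obj (F i)}
    (f : x ⟶ x') (g : ∀ i, y i ⟶ y' i) :
    (Φ.functor T).map ((A.mul σ hF).map (Prod.mkHom f g)) =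
      eqToHom (Φ.mul_obj σ hF x y) ≫
        (B.mul σ hF).map (Prod.mkHom ((Φ.functor S).map f) fun i => (Φ.functor (F i)).map (g i)) ≫
          eqToHom (Φ.mul_obj σ hF x' y').symm :=
  Functor.congr_hom (Φ.mul σ hF) (Prod.mkHom f g)

theorem app_eqToHom {X Y : Type*} [Category* X] [Category* Y] {G H : X ⥤ Y} (α : G ⟶ H) {x x' : X}
    (h : x = x') : α.app x = eqToHom (congrArg G.obj h) ≫ α.app x' ≫
      eqToHom (congrArg H.obj h.symm) := by
  cases h; simp

def whiskerLeft {A B D : CatOperad.{v, u} C} (Φ : A.OpFunctor B) {Ψ Θ : B.OpFunctor D}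
    (α : Ψ ⟶ Θ) : Φ.comp Ψ ⟶ Φ.comp Θ where
  app T := Functor.whiskerLeft (Φ.functor T) (α.app T)
  mul σ F hF x y := by
    refine (app_eqToHom (α.app _) (Φ.mul_obj σ hF x y)).trans ?_
    rw [α.mul]
    simp only [Category.assoc, eqToHom_trans, eqToHom_trans_assoc]
    rfl
  unit := by
    refine (app_eqToHom (α.app _) Φ.unit).trans ?_
    rw [α.unit]
    simp only [eqToHom_trans]
    rfl

def whiskerRight {A B D : CatOperad.{v, u} C} {Φ Ψ : A.OpFunctor B} (α : Φ ⟶ Ψ)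
    (Θ : B.OpFunctor D) : Φ.comp Θ ⟶ Ψ.comp Θ where
  app T := Functor.whiskerRight (α.app T) (Θ.functor T)
  mul σ F hF x y := by
    simp only [Functor.whiskerRight_app, α.mul, Functor.map_comp, eqToHom_map, Θ.mul_map,
      Category.assoc, eqToHom_trans, eqToHom_trans_assoc]
    rfl
  unit := by
    simp only [Functor.whiskerRight_app, α.unit, eqToHom_map]
    rfl

/-- The (strict) 2-category of categorical operads over `C`, operadic functors and operadic
natural transformations. -/
instance bicategory : Bicategory (CatOperad.{v, u} C) where
  Hom A B := A.OpFunctor B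
  id A := OpFunctor.id A
  comp Φ Ψ := Φ.comp Ψ
  homCategory A B := homCategory A B
  whiskerLeft Φ _ _ α := whiskerLeft Φ α
  whiskerRight α Θ := whiskerRight α Θ
  associator Φ Ψ Θ := Iso.refl (Φ.comp (Ψ.comp Θ))
  leftUnitor Φ := Iso.refl Φ
  rightUnitor Φ := Iso.refl Φ
  whiskerLeft_id _ _ := rfl
  whiskerLeft_comp _ _ _ _ _ _ := rfl
  id_whiskerLeft α := ((Category.id_comp _).trans (Category.comp_id _)).symm
  comp_whiskerLeft _ _ _ _ α := ((Category.id_comp _).trans (Category.comp_id _)).symm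
  id_whiskerRight _ Ψ := hom₂_ext fun _ => NatTrans.ext (funext fun _ => CategoryTheory.Functor.map_id _ _)
  comp_whiskerRight _ _ Ψ := hom₂_ext fun _ => NatTrans.ext (funext fun _ => Functor.map_comp _ _ _)
  whiskerRight_id α := ((Category.id_comp _).trans (Category.comp_id _)).symm
  whiskerRight_comp α _ _ := ((Category.id_comp _).trans (Category.comp_id _)).symm
  whisker_assoc _ _ _ _ _ := ((Category.id_comp _).trans (Category.comp_id _)).symm
  whisker_exchange α β := hom₂_ext fun _ => NatTrans.ext (funext fun _ =>
    ((β.app _).naturality _).symm)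
  pentagon _ _ _ Θ := by
    refine hom₂_ext fun _ => NatTrans.ext (funext fun _ => ?_)
    change (Θ.functor _).map (𝟙 _) ≫ 𝟙 _ ≫ 𝟙 _ = 𝟙 _ ≫ 𝟙 _
    simp
  triangle _ Ψ := by
    refine hom₂_ext fun _ => NatTrans.ext (funext fun _ => ?_)
    change 𝟙 _ ≫ 𝟙 _ = (Ψ.functor _).map (𝟙 _)
    simp

instance strict : Bicategory.Strict (CatOperad.{v, u} C) where
  id_comp _ := rfl
  comp_id _ := rfl
  assoc _ _ _ := rfl
  leftUnitor_eqToIso _ := rfl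
  rightUnitor_eqToIso _ := rfl
  associator_eqToIso _ _ _ := rfl

theorem assoc_obj (A : CatOperad.{v, u} C) {T S R : C} (σ : T ⟶ S) (ω : S ⟶ R)
    {X Y : Fin (card R) → C} {Z : Fin (card S) → C}
    (hX : Fibres (σ ≫ ω) X) (hY : Fibres ω Y) (hZ : Fibres σ Z)
    (τ : ∀ i, X i ⟶ Y i) (hτ : ∀ i, τ i ≫ hY.incl i = hX.incl i ≫ σ)
    (hW : ∀ i, Fibres (τ i) fun j => Z (tip (hY.incl i) j))
    (a : A.obj R) (b : ∀ i, A.obj (Y i)) (c : ∀ j, A.obj (Z j)) :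
    (A.mul σ hZ).obj ((A.mul ω hY).obj (a, b), c) =
      (A.mul (σ ≫ ω) hX).obj
        (a, fun i => (A.mul (τ i) (hW i)).obj (b i, fun j => c (tip (hY.incl i) j))) :=
  Functor.congr_obj (A.assoc σ ω hX hY hZ τ hτ hW
    (Cat.of (A.obj R × (∀ i, A.obj (Y i)) × (∀ j, A.obj (Z j))))
    (CategoryTheory.Prod.fst _ _)
    (fun i => CategoryTheory.Prod.snd _ _ ⋙ CategoryTheory.Prod.fst _ _ ⋙ Pi.eval _ i)
    (fun j => CategoryTheory.Prod.snd _ _ ⋙ CategoryTheory.Prod.snd _ _ ⋙ Pi.eval _ j)) (a, b, c)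

theorem mul_id_obj (A : CatOperad.{v, u} C) {T : C} (hF : Fibres (𝟙 T) fun _ => pt)
    (a : A.obj T) : (A.mul (𝟙 T) hF).obj (a, fun _ => A.unit) = a :=
  Functor.congr_obj (A.mul_id hF (A.obj T) (𝟭 _)) a

theorem id_mul_obj (A : CatOperad.{v, u} C) {T : C} (σ : T ⟶ pt) (hF : Fibres σ fun _ => T)
    (a : A.obj T) : (A.mul σ hF).obj (A.unit, fun _ => a) = a :=
  Functor.congr_obj (A.id_mul σ hF (A.obj T) (𝟭 _)) a

end CatOperad

open CatOperad

variable {C : Type} [FibreCat C]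

/-- An internal operad in a categorical operad `A`: objects `obj T` of `A.obj T`, morphisms
`mul σ : m_σ (a_S; a_{F 0}, …) ⟶ a_T` and `unit : e ⟶ a_pt`, associative and unital. -/
structure InternalOperad (A : CatOperad.{v, u} C) where
  obj : ∀ T, A.obj T
  mul : ∀ {T S : C} (σ : T ⟶ S) {F : Fin (card S) → C} (hF : Fibres σ F),
    (A.mul σ hF).obj (obj S, fun i => obj (F i)) ⟶ obj T
  unit : A.unit ⟶ obj pt
  assoc : ∀ {T S R : C} (σ : T ⟶ S) (ω : S ⟶ R) {X Y : Fin (card R) → C} {Z : Fin (card S) → C}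
    (hX : Fibres (σ ≫ ω) X) (hY : Fibres ω Y) (hZ : Fibres σ Z)
    (τ : ∀ i, X i ⟶ Y i) (hτ : ∀ i, τ i ≫ hY.incl i = hX.incl i ≫ σ)
    (hW : ∀ i, Fibres (τ i) fun j => Z (tip (hY.incl i) j)),
    (A.mul σ hZ).map (Prod.mkHom (mul ω hY) fun j => 𝟙 (obj (Z j))) ≫ mul σ hZ =
      eqToHom (A.assoc_obj σ ω hX hY hZ τ hτ hW (obj R) (fun i => obj (Y i)) fun j => obj (Z j)) ≫
        (A.mul (σ ≫ ω) hX).map (Prod.mkHom (𝟙 (obj R)) fun i => mul (τ i) (hW i)) ≫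
          mul (σ ≫ ω) hX
  mul_id : ∀ {T : C} (hF : Fibres (𝟙 T) fun _ => pt),
    (A.mul (𝟙 T) hF).map (Prod.mkHom (𝟙 (obj T)) fun _ => unit) ≫ mul (𝟙 T) hF =
      eqToHom (A.mul_id_obj hF (obj T))
  id_mul : ∀ {T : C} (σ : T ⟶ pt) (hF : Fibres σ fun _ => T),
    (A.mul σ hF).map (Prod.mkHom unit fun _ => 𝟙 (obj T)) ≫ mul σ hF =
      eqToHom (A.id_mul_obj σ hF (obj T))

namespace InternalOperad

/-- Morphisms of internal operads. -/
@[ext]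
structure Hom {A : CatOperad.{v, u} C} (a b : InternalOperad A) where
  app : ∀ T, a.obj T ⟶ b.obj T
  mul : ∀ {T S : C} (σ : T ⟶ S) {F : Fin (card S) → C} (hF : Fibres σ F),
    a.mul σ hF ≫ app T = (A.mul σ hF).map (Prod.mkHom (app S) fun i => app (F i)) ≫ b.mul σ hF
  unit : a.unit ≫ app pt = b.unit

instance category (A : CatOperad.{v, u} C) : Category (InternalOperad A) where
  Hom a b := Hom a b
  id a := ⟨fun _ => 𝟙 _, fun {T S} σ {F} hF => by
    have : (Prod.mkHom (𝟙 (a.obj S)) fun i => 𝟙 (a.obj (F i))) =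
      𝟙 (a.obj S, fun i => a.obj (F i)) := rfl
    simp [this], by simp⟩
  comp f g := ⟨fun T => f.app T ≫ g.app T, fun {T S} σ {F} hF => by
    rw [← Category.assoc, f.mul, Category.assoc, g.mul, ← Functor.map_comp_assoc]; rfl,
    by rw [← Category.assoc, f.unit, g.unit]⟩
  id_comp f := Hom.ext (funext fun _ => Category.id_comp _)
  comp_id f := Hom.ext (funext fun _ => Category.comp_id _)
  assoc f g h := Hom.ext (funext fun _ => Category.assoc _ _ _)

theorem hom_ext {A : CatOperad.{v, u} C} {a b : InternalOperad A} {f g : a ⟶ b}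
    (h : ∀ T, f.app T = g.app T) : f = g :=
  Hom.ext (funext h)

theorem ext' {A : CatOperad.{v, u} C} {a b : InternalOperad A} (h : a.obj = b.obj)
    (hm : ∀ {T S : C} (σ : T ⟶ S) {F : Fin (card S) → C} (hF : Fibres σ F),
      HEq (a.mul σ hF) (b.mul σ hF)) (hu : HEq a.unit b.unit) : a = b := by
  obtain ⟨ao, am, au, _, _, _⟩ := a
  obtain ⟨bo, bm, bu, _, _, _⟩ := b
  obtain rfl : ao = bo := h
  obtain rfl : au = bu := eq_of_heq hu
  obtain rfl : @am = @bm := by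
    funext T S σ F hF
    exact eq_of_heq (hm σ hF)
  rfl

theorem mul_map_eqToHom (A : CatOperad.{v, u} C) {T S : C} (σ : T ⟶ S)
    {F : Fin (card S) → C} (hF : Fibres σ F) {x x' x'' : A.obj S} {y y' y'' : ∀ i, A.obj (F i)}
    (h : x = x') (f : x' ⟶ x'') (hy : ∀ i, y i = y' i) (g : ∀ i, y' i ⟶ y'' i) :
    (A.mul σ hF).map (Prod.mkHom (eqToHom h ≫ f) fun i => eqToHom (hy i) ≫ g i) =
      eqToHom (by rw [h, funext hy]) ≫ (A.mul σ hF).map (Prod.mkHom f g) := by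
  subst h
  obtain rfl : y = y' := funext hy
  simp

theorem mul_map_functor {A B : CatOperad.{v, u} C} (Φ : A.OpFunctor B) {T S : C} (σ : T ⟶ S)
    {F : Fin (card S) → C} (hF : Fibres σ F) {z : B.obj S} {x x' : A.obj S}
    {w : ∀ i, B.obj (F i)} {y y' : ∀ i, A.obj (F i)}
    (h : z = (Φ.functor S).obj x) (f : x ⟶ x') (hy : ∀ i, w i = (Φ.functor (F i)).obj (y i))
    (g : ∀ i, y i ⟶ y' i) :
    (B.mul σ hF).map (Prod.mkHom (eqToHom h ≫ (Φ.functor S).map f)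
        fun i => eqToHom (hy i) ≫ (Φ.functor (F i)).map (g i)) =
      eqToHom (by rw [h, funext hy, Φ.mul_obj]) ≫
        (Φ.functor T).map ((A.mul σ hF).map (Prod.mkHom f g)) ≫
          eqToHom (Φ.mul_obj σ hF x' y') := by
  rw [mul_map_eqToHom, Φ.mul_map]
  simp

/-- The image of an internal operad under an operadic functor. -/
def mapObj {A B : CatOperad.{v, u} C} (Φ : A.OpFunctor B) (a : InternalOperad A) :
    InternalOperad B where
  obj T := (Φ.functor T).obj (a.obj T)
  mul σ F hF := eqToHom (Φ.mul_obj σ hF _ _).symm ≫ (Φ.functor _).map (a.mul σ hF)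
  unit := eqToHom Φ.unit.symm ≫ (Φ.functor pt).map a.unit
  assoc σ ω X Y Z hX hY hZ τ hτ hW := by
    have h1 := mul_map_functor Φ σ hZ (Φ.mul_obj ω hY _ _).symm (a.mul ω hY) (fun _ => rfl)
      (fun j => 𝟙 (a.obj (Z j)))
    have h2 := mul_map_functor Φ (σ ≫ ω) hX rfl (𝟙 (a.obj _))
      (fun i => (Φ.mul_obj (τ i) (hW i) _ _).symm) (fun i => a.mul (τ i) (hW i))
    simp only [eqToHom_refl, Category.id_comp, CategoryTheory.Functor.map_id] at h1 h2
    rw [h1, h2]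
    simp only [Category.assoc, eqToHom_trans_assoc, eqToHom_refl, Category.id_comp]
    rw [← Functor.map_comp, ← Functor.map_comp, a.assoc σ ω hX hY hZ τ hτ hW,
      Functor.map_comp, eqToHom_map]
    simp only [eqToHom_trans_assoc]
  mul_id hF := by
    have h1 := mul_map_functor Φ (𝟙 _) hF rfl (𝟙 (a.obj _)) (fun _ => Φ.unit.symm)
      (fun _ => a.unit)
    simp only [eqToHom_refl, Category.id_comp, CategoryTheory.Functor.map_id] at h1
    rw [h1]
    simp only [Category.assoc, eqToHom_trans_assoc, eqToHom_refl, Category.id_comp]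
    rw [← Functor.map_comp, a.mul_id, eqToHom_map, eqToHom_trans]
  id_mul σ hF := by
    have h1 := mul_map_functor Φ σ hF Φ.unit.symm a.unit (fun _ => rfl) (fun _ => 𝟙 (a.obj _))
    simp only [eqToHom_refl, Category.id_comp, CategoryTheory.Functor.map_id] at h1
    rw [h1]
    simp only [Category.assoc, eqToHom_trans_assoc, eqToHom_refl, Category.id_comp]
    rw [← Functor.map_comp, a.id_mul, eqToHom_map, eqToHom_trans]

def map {A B : CatOperad.{v, u} C} (Φ : A.OpFunctor B) : InternalOperad A ⥤ InternalOperad B where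
  obj a := mapObj Φ a
  map {a b} f := ⟨fun T => (Φ.functor T).map (f.app T), fun {T S} σ {F} hF => by
    have h1 := mul_map_functor Φ σ hF rfl (f.app S) (fun _ => rfl) (fun i => f.app (F i))
    simp only [eqToHom_refl, Category.id_comp] at h1
    dsimp only [mapObj]
    rw [h1, Category.assoc, ← Functor.map_comp, f.mul, Functor.map_comp]
    simp, by
    dsimp only [mapObj]
    rw [Category.assoc, ← Functor.map_comp, f.unit]⟩
  map_id a := hom_ext fun _ => CategoryTheory.Functor.map_id _ _
  map_comp f g := hom_ext fun _ => Functor.map_comp _ _ _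

def map₂ {A B : CatOperad.{v, u} C} {Φ Ψ : A.OpFunctor B} (α : Φ ⟶ Ψ) : map Φ ⟶ map Ψ where
  app a := ⟨fun T => (α.app T).app (a.obj T), fun σ F hF => by
    have := (α.app _).naturality (a.mul σ hF)
    dsimp only [map, mapObj]
    rw [Category.assoc, this, α.mul]
    simp, by
    have := (α.app _).naturality a.unit
    dsimp only [map, mapObj]
    rw [Category.assoc, this, α.unit]
    simp⟩
  naturality a b f := hom_ext fun _ => (α.app _).naturality _

theorem eqToHom_app {A : CatOperad.{v, u} C} {a b : InternalOperad A} (h : a = b) (T : C) :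
    Hom.app (eqToHom h) T = eqToHom (congrArg (fun x => x.obj T) h) := by
  cases h; rfl

@[simp] theorem category_comp_app {A : CatOperad.{v, u} C} {a b c : InternalOperad A}
    (f : a ⟶ b) (g : b ⟶ c) (T : C) : Hom.app (f ≫ g) T = f.app T ≫ g.app T := rfl

theorem conj_app {A : CatOperad.{v, u} C} {a b c d : InternalOperad A} (p : a = b) (f : b ⟶ c)
    (q : c = d) (T : C) (g : a.obj T ⟶ d.obj T) (h : HEq g (f.app T)) :
    g = Hom.app (eqToHom p ≫ f ≫ eqToHom q) T := by
  subst p q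
  rw [eqToHom_refl, Category.id_comp, eqToHom_refl, Category.comp_id]
  exact eq_of_heq h

theorem functor_ext {A B : CatOperad.{v, u} C} {G H : InternalOperad A ⥤ InternalOperad B}
    (hobj : ∀ a, G.obj a = H.obj a)
    (hmap : ∀ {a b} (f : a ⟶ b) (T : C), HEq ((G.map f).app T) ((H.map f).app T)) : G = H :=
  CategoryTheory.Functor.ext hobj fun a b f => hom_ext fun T => by
    exact conj_app _ _ _ T _ (hmap f T)

theorem map_id (A : CatOperad.{v, u} C) : map (𝟙 A) = 𝟭 (InternalOperad A) :=
  functor_ext (fun a => ext' rfl (fun σ _ hF => heq_of_eq (Category.id_comp _))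
    (heq_of_eq (Category.id_comp _))) fun _ _ => HEq.rfl

theorem eqToHom_map_aux {X Y : Type*} [Category* X] [Category* Y] (G : X ⥤ Y) {w : Y} {x y z : X}
    (r : x = y) (f : y ⟶ z) (p : w = G.obj y) (q : w = G.obj x) :
    eqToHom p ≫ G.map f = eqToHom q ≫ G.map (eqToHom r ≫ f) := by
  subst r; simp

theorem map_comp {A B D : CatOperad.{v, u} C} (Φ : A ⟶ B) (Ψ : B ⟶ D) :
    map (Φ ≫ Ψ) = map Φ ⋙ map Ψ :=
  functor_ext (fun a => ext' rfl
    (fun σ _ hF => heq_of_eq (eqToHom_map_aux (Ψ.functor _) _ _ _ _))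
    (heq_of_eq (eqToHom_map_aux (Ψ.functor _) _ _ _ _))) fun _ _ => HEq.rfl

end InternalOperad

/-- The 2-functor which assigns to a categorical operad its category of internal operads. -/
def IntOp (C : Type) [FibreCat C] : StrictPseudofunctor (CatOperad.{v, u} C) Cat.{v, max v u} :=
  StrictPseudofunctor.mk''
    { obj := fun A => Cat.of (InternalOperad A)
      map := fun Φ => (InternalOperad.map Φ).toCatHom
      map₂ := fun α => (InternalOperad.map₂ α).toCatHom₂
      map₂_id := fun _ => rfl
      map₂_comp := fun _ _ => rfl
      map_id := fun A => congrArg Functor.toCatHom (InternalOperad.map_id A)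
      map_comp := fun Φ Ψ => congrArg Functor.toCatHom (InternalOperad.map_comp Φ Ψ)
      map₂_whisker_left := fun Φ _ _ α => by
        ext a
        refine InternalOperad.hom_ext fun T => ?_
        simp only [Cat.Hom₂.comp_app, Cat.eqToHom_app]
        exact InternalOperad.conj_app _ _ _ T _ HEq.rfl
      map₂_whisker_right := fun α Φ => by
        ext a
        refine InternalOperad.hom_ext fun T => ?_
        simp only [Cat.Hom₂.comp_app, Cat.eqToHom_app]
        exact InternalOperad.conj_app _ _ _ T _ HEq.rfl }

/-- Objects `[n]`, `n ≥ 0`, of the category of finite ordinals and ALL maps. -/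
structure OmegaS where
  size : ℕ

instance : FibreCat OmegaS where
  Hom n k := Fin n.size → Fin k.size
  id _ := fun x => x
  comp f g := fun x => g (f x)
  card n := n.size
  tip f := f
  pt := ⟨1⟩
  IsFibre {n k d} (σ : Fin n.size → Fin k.size) i (ι : Fin d.size → Fin n.size) :=
    StrictMono ι ∧ Set.range ι = {x | σ x = i}

/-- Objects `[n]`, `n ≥ 0`, of the category of finite ordinals and order preserving maps. -/
structure OmegaMono where
  size : ℕ

instance : FibreCat OmegaMono where
  Hom n k := Fin n.size →o Fin k.size
  id _ := OrderHom.id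
  comp f g := g.comp f
  card n := n.size
  tip f := f
  pt := ⟨1⟩
  IsFibre {n k d} (σ : Fin n.size →o Fin k.size) i (ι : Fin d.size →o Fin n.size) :=
    StrictMono ι ∧ Set.range ι = {x | σ x = i}

/-- An `n`-tree, that is, a chain of order preserving maps of finite ordinals
`[k_n] ⟶ [k_{n-1}] ⟶ … ⟶ [k_0] = [1]`, where `[k]` is the ordinal with `k ≥ 0` elements. Its tips
are the elements of `[k_n]`. -/
structure NTree (n : ℕ) where
  width : Fin (n + 1) → ℕ
  width_zero : width 0 = 1
  parent : ∀ m : Fin n, Fin (width m.succ) → Fin (width m.castSucc)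
  parent_mono : ∀ m, Monotone (parent m)

namespace NTree

variable {n : ℕ}

/-- Morphisms of trees: families of maps, not necessarily monotone, which commute with the
structure maps and which preserve the order on each fibre of the structure maps. -/
@[ext]
structure Hom (T S : NTree n) where
  map : ∀ m, Fin (T.width m) → Fin (S.width m)
  comm : ∀ (m : Fin n) x, map m.castSucc (T.parent m x) = S.parent m (map m.succ x)
  mono : ∀ (m : Fin n) x y, T.parent m x = T.parent m y → x ≤ y → map m.succ x ≤ map m.succ y

/-- The terminal tree `U_n`, with one vertex in each level. -/
def linear (n : ℕ) : NTree n where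
  width _ := 1
  width_zero := rfl
  parent _ x := x
  parent_mono _ := monotone_id

def card (T : NTree n) : ℕ := T.width (Fin.last n)

/-- The category `Ω_n` of `n`-trees. -/
instance : Category.{0} (NTree n) where
  Hom T S := Hom T S
  id T := ⟨fun _ x => x, fun _ _ => rfl, fun _ _ _ _ h => h⟩
  comp f g := ⟨fun m x => g.map m (f.map m x), fun m x => by rw [f.comm, g.comm],
    fun m x y h hxy => g.mono m _ _ (by rw [← f.comm, ← f.comm, h]) (f.mono m x y h hxy)⟩

/-- The fibre of `σ : T ⟶ S` over a tip `i` of `S` consists of the vertices of `T` which `σ`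
sends to the branch of `S` from the root to `i`; this branch is the morphism `ξ : U_n ⟶ S`. -/
instance : FibreCat (NTree n) where
  card := card
  tip f := f.map (Fin.last n)
  pt := linear n
  IsFibre {T S F} σ i ι := ∃ ξ : linear n ⟶ S, ξ.map (Fin.last n) (0 : Fin 1) = i ∧
    ∀ m, StrictMono (ι.map m) ∧ Set.range (ι.map m) = {x | σ.map m x = ξ.map m (0 : Fin 1)}

end NTree

/-- A left symmetric categorical operad: an operad over the category of finite ordinals and
order preserving maps, with a left action of the symmetric group of `[n]` on `obj n`, subject to
two equivariance laws.

`mul_act`: permuting the outer argument by `ρ` amounts to permuting the inner arguments, up to the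
block permutation `π`, which covers `ρ` and preserves the order within each block.
`mul_act_fibre`: permuting the inner arguments by `θ i` amounts to applying the permutation `π`
which preserves each block and restricts to `θ i` on it. -/
structure SymOperad extends CatOperad.{v, u} OmegaMono where
  act : ∀ n : OmegaMono, Equiv.Perm (Fin n.size) → (obj n ⥤ obj n)
  act_one : ∀ n, act n 1 = 𝟭 (obj n)
  act_mul : ∀ (n) (π ρ : Equiv.Perm (Fin n.size)), act n (π * ρ) = act n ρ ⋙ act n π
  mul_act : ∀ {n k : OmegaMono} (σ σ' : n ⟶ k) (ρ : Equiv.Perm (Fin k.size))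
    (π : Equiv.Perm (Fin n.size)), (∀ x, ρ (tip σ' x) = tip σ (π x)) →
    (∀ x y, tip σ' x = tip σ' y → x ≤ y → π x ≤ π y) →
    ∀ {d : Fin k.size → OmegaMono} (hd : Fibres σ d) (hd' : Fibres σ' fun i => d (ρ i))
    (E : Cat.{v, u}) (a : E ⥤ obj k) (b : ∀ i, E ⥤ obj (d i)),
    tuple (a ⋙ act k ρ) b ⋙ mul σ hd = tuple a (fun i => b (ρ i)) ⋙ mul σ' hd' ⋙ act n π
  mul_act_fibre : ∀ {n k : OmegaMono} (σ : n ⟶ k) (π : Equiv.Perm (Fin n.size))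
    {d : Fin k.size → OmegaMono} (hd : Fibres σ d)
    (θ : ∀ i, Equiv.Perm (Fin (d i).size)), (∀ i x, tip (hd.incl i) (θ i x) = π (tip (hd.incl i) x)) →
    ∀ (E : Cat.{v, u}) (a : E ⥤ obj k) (b : ∀ i, E ⥤ obj (d i)),
    tuple a (fun i => b i ⋙ act (d i) (θ i)) ⋙ mul σ hd = tuple a b ⋙ mul σ hd ⋙ act n π


theorem perm_inv_self {n : ℕ} (p : Equiv.Perm (Fin n)) (x : Fin n) : p⁻¹ (p x) = x :=
  p.symm_apply_apply x

theorem perm_self_inv {n : ℕ} (p : Equiv.Perm (Fin n)) (x : Fin n) : p (p⁻¹ x) = x :=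
  p.apply_symm_apply x

namespace OmegaMono

instance {n k : OmegaMono} (σ : n ⟶ k) (F : Fin k.size → OmegaMono) :
    Subsingleton (Fibres σ F) := by
  refine ⟨fun ⟨f, hf⟩ ⟨g, hg⟩ => ?_⟩
  obtain rfl : f = g := funext fun i => OrderHom.ext _ _
    ((StrictMono.range_inj (hf i).1 (hg i).1).1 ((hf i).2.trans (hg i).2.symm))
  rfl

def Fibres.copy {n k : OmegaMono} {σ σ' : n ⟶ k} (h : σ = σ') {F : Fin k.size → OmegaMono}
    (hF : Fibres σ F) : Fibres σ' F :=
  ⟨hF.incl, h ▸ hF.isFibre⟩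

end OmegaMono

namespace OmegaS

abbrev mono (n : OmegaS) : OmegaMono := ⟨n.size⟩

/-- Every map `f` is uniquely a bijection which preserves the order on the fibres of `f`, followed
by an order preserving map; `perm f` is this bijection. -/
def perm {n k : ℕ} (f : Fin n → Fin k) : Equiv.Perm (Fin n) :=
  (Tuple.sort f)⁻¹

theorem perm_inv_monotone {n k : ℕ} (f : Fin n → Fin k) : Monotone fun x => f ((perm f)⁻¹ x) :=
  Tuple.monotone_sort f

theorem perm_inv_lt {n k : ℕ} (f : Fin n → Fin k) {x y : Fin n} (h : x < y)
    (hxy : f ((perm f)⁻¹ x) = f ((perm f)⁻¹ y)) : (perm f)⁻¹ x < (perm f)⁻¹ y :=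
  (Tuple.eq_sort_iff.1 (rfl : Tuple.sort f = _)).2 x y h hxy

theorem perm_lt {n k : ℕ} (f : Fin n → Fin k) {x y : Fin n} (h : x < y)
    (hxy : f x = f y) : perm f x < perm f y := by
  by_contra hn
  rcases (not_lt.1 hn).eq_or_lt with h' | h'
  · exact h.ne ((perm f).injective h'.symm)
  · have := perm_inv_lt f h' (by simpa using hxy.symm)
    rw [perm_inv_self, perm_inv_self] at this
    exact lt_asymm h this

theorem perm_eq_one {n k : ℕ} {f : Fin n → Fin k} (h : Monotone f) : perm f = 1 :=
  inv_eq_one.2 (Tuple.sort_eq_refl_iff_monotone.2 h)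

section

variable {n l k : ℕ} (f : Fin n → Fin l) (g : Fin l → Fin k)

theorem perm_comp (x : Fin n) :
    g (f ((perm f)⁻¹ ((perm fun y => perm g (f ((perm f)⁻¹ y)))⁻¹ x))) =
      g (f ((perm fun y => g (f y))⁻¹ x)) := by
  have h := (Tuple.comp_sort_eq_comp_iff_monotone (f := fun y => g (f y))
    (σ := (perm f)⁻¹ * (perm fun y => perm g (f ((perm f)⁻¹ y)))⁻¹)).2 (by
      intro x y hxy
      have := perm_inv_monotone g (perm_inv_monotone (fun y => perm g (f ((perm f)⁻¹ y))) hxy)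
      simpa using this)
  rw [show Tuple.sort (fun y => g (f y)) = (perm fun y => g (f y))⁻¹ from (inv_inv _).symm] at h
  exact congrFun h x

theorem perm_comp_fibre {i : Fin k} {p r : ℕ} {ι : Fin p → Fin n} (hι : StrictMono ι)
    (hι' : Set.range ι = {x | g (f x) = i}) {κ : Fin r → Fin l} (hκ : StrictMono κ)
    {τ : Fin p → Fin r} (hτ : ∀ x, κ (τ x) = f (ι x)) :
    (fun x => (perm f)⁻¹ ((perm fun y => perm g (f ((perm f)⁻¹ y)))⁻¹
      ((perm fun y => g (f y)) (ι x)))) = fun x => ι ((perm τ)⁻¹ x) := by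
  set q := perm fun y => perm g (f ((perm f)⁻¹ y)) with hq
  set w := perm fun y => g (f y) with hw
  have hc : ∀ x, g (f ((perm f)⁻¹ (q⁻¹ x))) = g (f (w⁻¹ x)) := perm_comp f g
  have hi : ∀ z, g (f (ι z)) = i := fun z => hι'.subset ⟨z, rfl⟩
  have hz : ∀ z, g (f ((perm f)⁻¹ (q⁻¹ (w (ι z))))) = i := fun z => by
    rw [hc, perm_inv_self, hi]
  -- both sides are increasing enumerations of the same set, for the lexicographic order
  have h1 : StrictMono fun x => toLex
      (f ((perm f)⁻¹ (q⁻¹ (w (ι x)))), (perm f)⁻¹ (q⁻¹ (w (ι x)))) := by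
    intro x y hxy
    rw [Prod.Lex.toLex_lt_toLex]
    have huv : w (ι x) < w (ι y) := perm_lt _ (hι hxy) ((hi x).trans (hi y).symm)
    rcases (perm_inv_monotone (fun y => perm g (f ((perm f)⁻¹ y))) huv.le).eq_or_lt with h | h
    · have h' := (perm g).injective h
      exact Or.inr ⟨h', perm_inv_lt f (perm_inv_lt _ huv h) h'⟩
    · refine Or.inl ?_
      have h' := perm_inv_lt g h (by
        rw [← hq, perm_inv_self, perm_inv_self, hz, hz])
      rwa [← hq, perm_inv_self, perm_inv_self] at h'
  have h2 : StrictMono fun x => toLex (f (ι ((perm τ)⁻¹ x)), ι ((perm τ)⁻¹ x)) := by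
    intro x y hxy
    rw [Prod.Lex.toLex_lt_toLex, ← hτ, ← hτ]
    rcases (perm_inv_monotone τ hxy.le).eq_or_lt with h | h
    · exact Or.inr ⟨congrArg κ h, hι (perm_inv_lt τ hxy h)⟩
    · exact Or.inl (hκ h)
  have h3 := (h1.range_inj h2).1 (by
    ext z
    constructor
    · rintro ⟨x, rfl⟩
      obtain ⟨y, hy⟩ := hι'.superset (hz x)
      exact ⟨perm τ y, by simp only [perm_inv_self, hy]⟩
    · rintro ⟨x, rfl⟩
      obtain ⟨y, hy⟩ := hι'.superset (show g (f (w⁻¹ (q (perm f (ι ((perm τ)⁻¹ x)))))) = i by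
        rw [← hc, perm_inv_self, perm_inv_self, hi])
      exact ⟨y, by simp only [hy, perm_inv_self, perm_self_inv]⟩)
  funext x
  exact congrArg (fun z => (ofLex z).2) (congrFun h3 x)

end

/-- The order preserving part of a map `σ`, so that `σ` is `perm σ` followed by `sorted σ`. -/
def sorted {n k : OmegaS} (σ : n ⟶ k) : n.mono ⟶ k.mono :=
  (⟨_, perm_inv_monotone (tip σ)⟩ : Fin n.size →o Fin k.size)

/-- The fibres of `σ` and of its order preserving part are the same ordinals. -/
def sortedFibres {n k : OmegaS} {σ : n ⟶ k} {F : Fin k.size → OmegaS} (hF : Fibres σ F) :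
    Fibres (sorted σ) fun i => (F i).mono where
  incl i := (⟨fun x => perm (tip σ) (tip (hF.incl i) x), fun x y h => by
    rcases h.eq_or_lt with rfl | h
    · exact le_rfl
    · have h1 : ∀ z, tip σ (tip (hF.incl i) z) = i := fun z =>
        (hF.isFibre i).2.subset ⟨z, rfl⟩
      exact (perm_lt (tip σ) ((hF.isFibre i).1 h) ((h1 x).trans (h1 y).symm)).le⟩ :
        Fin (F i).size →o Fin n.size)
  isFibre i := by
    have h1 : ∀ z, tip σ (tip (hF.incl i) z) = i := fun z =>
        (hF.isFibre i).2.subset ⟨z, rfl⟩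
    refine ⟨fun x y h => perm_lt (tip σ) ((hF.isFibre i).1 h) ((h1 x).trans (h1 y).symm), ?_⟩
    ext z
    constructor
    · rintro ⟨x, rfl⟩
      change tip σ ((perm (tip σ))⁻¹ (perm (tip σ) _)) = i
      simpa using h1 x
    · intro hz
      obtain ⟨x, hx⟩ := (hF.isFibre i).2.superset hz
      exact ⟨x, (congrArg (perm (tip σ)) hx).trans (perm_self_inv _ _)⟩

end OmegaS

namespace SymOperad

open OmegaS

variable (A : SymOperad.{v, u})

theorem mul_congr {n k : OmegaMono} {σ σ' : n ⟶ k} (h : σ = σ') {F : Fin k.size → OmegaMono}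
    (hF : Fibres σ F) (hF' : Fibres σ' F) : A.mul σ hF = A.mul σ' hF' := by
  subst h
  rw [Subsingleton.elim hF hF']

theorem tuple_congr {l : ℕ} {n k : OmegaMono} (σ : n ⟶ k) {Z : Fin l → OmegaMono}
    {p q : Fin k.size → Fin l} (h : p = q) (hp : Fibres σ fun j => Z (p j))
    (hq : Fibres σ fun j => Z (q j)) (E : Cat.{v, u}) (a : E ⥤ A.obj k)
    (c : ∀ j, E ⥤ A.obj (Z j)) :
    tuple a (fun j => c (p j)) ⋙ A.mul σ hp = tuple a (fun j => c (q j)) ⋙ A.mul σ hq := by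
  subst h
  rw [Subsingleton.elim hp hq]

/-- The multiplication, for arbitrary maps `σ`, of the operad over `OmegaS` that corresponds to
a left symmetric operad: first multiply for the order preserving part of `σ`, then act by the
inverse of the bijective part. -/
def toSMul {n k : OmegaS} (σ : n ⟶ k) {F : Fin k.size → OmegaS} (hF : Fibres σ F) :
    A.obj k.mono × (∀ i, A.obj (F i).mono) ⥤ A.obj n.mono :=
  A.mul (sorted σ) (sortedFibres hF) ⋙ A.act n.mono (perm (tip σ))⁻¹

theorem toSMul_of_monotone {n k : OmegaS} (σ : n ⟶ k) {F : Fin k.size → OmegaS}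
    (hF : Fibres σ F) (τ : n.mono ⟶ k.mono) (h : ∀ x, tip σ x = tip τ x)
    (hF' : Fibres τ fun i => (F i).mono) : A.toSMul σ hF = A.mul τ hF' := by
  have hp : perm (tip σ) = 1 := perm_eq_one (by
    have : tip σ = tip τ := funext h
    rw [this]; exact OrderHom.monotone (α := Fin n.size) (β := Fin k.size) τ)
  have hs : sorted σ = τ := OrderHom.ext (α := Fin n.size) (β := Fin k.size) _ _ (funext fun x => by
    change tip σ ((perm (tip σ))⁻¹ x) = _
    rw [hp]; exact h x)
  rw [toSMul, hp, A.mul_congr hs _ hF', inv_one, A.act_one]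
  rfl

theorem toS_assoc {n l k : OmegaS} (f : n ⟶ l) (g : l ⟶ k) {X Y : Fin k.size → OmegaS}
    {Z : Fin l.size → OmegaS} (hX : Fibres (f ≫ g) X) (hY : Fibres g Y) (hZ : Fibres f Z)
    (τ : ∀ i, X i ⟶ Y i) (hτ : ∀ i, τ i ≫ hY.incl i = hX.incl i ≫ f)
    (hW : ∀ i, Fibres (τ i) fun j => Z (tip (hY.incl i) j))
    (E : Cat.{v, u}) (a : E ⥤ A.obj k.mono) (b : ∀ i, E ⥤ A.obj (Y i).mono)
    (c : ∀ j, E ⥤ A.obj (Z j).mono) :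
    tuple (tuple a b ⋙ A.toSMul g hY) c ⋙ A.toSMul f hZ =
      tuple a (fun i => tuple (b i) (fun j => c (tip (hY.incl i) j)) ⋙ A.toSMul (τ i) (hW i)) ⋙
        A.toSMul (f ≫ g) hX := by
  -- the order preserving part of `f` followed by the bijective part of `g`
  let q : n ⟶ l := fun x => perm g (f ((perm f)⁻¹ x))
  have hsg : sorted q ≫ sorted g = sorted (f ≫ g) :=
    OrderHom.ext (α := Fin n.size) (β := Fin k.size) _ _ (funext fun x =>
      (congrArg (tip g) (perm_inv_self (perm g) _)).trans (perm_comp f g x))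
  let hX' : Fibres (sorted q ≫ sorted g) fun i => (X i).mono :=
    OmegaMono.Fibres.copy hsg.symm (sortedFibres hX)
  have hqZ : Fibres (sorted q) fun j => (Z ((perm g)⁻¹ j)).mono := sortedFibres
    (F := fun j => Z ((perm g)⁻¹ j))
    ⟨fun j x => perm f (tip (hZ.incl ((perm g)⁻¹ j)) x), fun j => by
      have hj : ∀ z, f (tip (hZ.incl ((perm g)⁻¹ j)) z) = (perm g)⁻¹ j := fun z =>
        (hZ.isFibre _).2.subset ⟨z, rfl⟩
      refine ⟨fun x y h => perm_lt f ((hZ.isFibre _).1 h) ((hj x).trans (hj y).symm), ?_⟩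
      ext z
      constructor
      · rintro ⟨x, rfl⟩
        change perm g (f ((perm f)⁻¹ (perm f _))) = j
        rw [perm_inv_self, hj, perm_self_inv]
      · intro hz
        have hz' : f ((perm f)⁻¹ z) = (perm g)⁻¹ j := by
          rw [← perm_inv_self (perm g) (f _)]
          exact congrArg _ hz
        obtain ⟨x, hx⟩ := (hZ.isFibre ((perm g)⁻¹ j)).2.superset hz'
        exact ⟨x, (congrArg (perm f) hx).trans (perm_self_inv _ _)⟩⟩
  have hτ' : ∀ i x, tip (hY.incl i) (τ i x) = f (tip (hX.incl i) x) := fun i x =>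
    congrFun (hτ i) x
  have hpc : ∀ i x, (perm f)⁻¹ ((perm q)⁻¹ (perm (tip (f ≫ g)) (tip (hX.incl i) x))) =
      tip (hX.incl i) ((perm (τ i))⁻¹ x) := fun i x =>
    congrFun (perm_comp_fibre f g (hX.isFibre i).1 (hX.isFibre i).2 (hY.isFibre i).1 (hτ' i)) x
  have hW' : ∀ i, Fibres (sorted (τ i))
      fun j => (Z ((perm g)⁻¹ (perm g (tip (hY.incl i) j)))).mono := fun i => by
    have e : (fun j => (Z ((perm g)⁻¹ (perm g (tip (hY.incl i) j)))).mono) =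
        fun j => (Z (tip (hY.incl i) j)).mono := funext fun j => by rw [perm_inv_self]
    exact cast (congrArg (Fibres (sorted (τ i))) e.symm) (sortedFibres (hW i))
  have h1 := A.mul_act (sorted f) (sorted q) (perm g)⁻¹ (perm q)⁻¹
    (fun x => perm_inv_self (perm g) _) (fun x y hxy h => by
    rcases h.eq_or_lt with rfl | h
    · exact le_rfl
    · exact (perm_inv_lt q h hxy).le) (sortedFibres hZ) hqZ E
        (tuple a b ⋙ A.mul (sorted g) (sortedFibres hY)) c
  have h2 := A.assoc (sorted q) (sorted g) hX' (sortedFibres hY) hqZ (fun i => sorted (τ i))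
    (fun i => OrderHom.ext (α := Fin (X i).size) (β := Fin l.size) _ _ (funext fun x => by
      change perm g (tip (hY.incl i) (τ i ((perm (τ i))⁻¹ x))) =
        perm g (f ((perm f)⁻¹ ((perm q)⁻¹ (perm (tip (f ≫ g)) (tip (hX.incl i) x)))))
      rw [hpc, hτ'])) hW' E a b (fun j => c ((perm g)⁻¹ j))
  have h3 := A.mul_act_fibre (sorted (f ≫ g)) (perm (tip (f ≫ g)) * (perm f)⁻¹ * (perm q)⁻¹)
    (sortedFibres hX) (fun i => (perm (τ i))⁻¹) (fun i x => by
      exact (congrArg (perm (tip (f ≫ g))) (hpc i x)).symm) E a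
      (fun i => tuple (b i) (fun j => c (tip (hY.incl i) j)) ⋙
        A.mul (sorted (τ i)) (sortedFibres (hW i)))
  have h4 : ∀ i, tuple (b i) (fun j => c ((perm g)⁻¹ (perm g (tip (hY.incl i) j)))) ⋙
      A.mul (sorted (τ i)) (hW' i) = tuple (b i) (fun j => c (tip (hY.incl i) j)) ⋙
        A.mul (sorted (τ i)) (sortedFibres (hW i)) := fun i =>
    A.tuple_congr (sorted (τ i)) (Z := fun j => (Z j).mono)
      (p := fun j => (perm g)⁻¹ (perm g (tip (hY.incl i) j))) (q := fun j => tip (hY.incl i) j)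
      (funext fun j => perm_inv_self _ _) (hW' i) (sortedFibres (hW i)) E (b i) c
  have h5 : tuple (tuple a b ⋙ A.mul (sorted g) (sortedFibres hY)) (fun j => c ((perm g)⁻¹ j)) ⋙
      A.mul (sorted q) hqZ = tuple a (fun i => tuple (b i) (fun j => c (tip (hY.incl i) j)) ⋙
        A.mul (sorted (τ i)) (sortedFibres (hW i))) ⋙ A.mul (sorted (f ≫ g)) (sortedFibres hX) := by
    refine h2.trans ?_
    rw [A.mul_congr hsg hX' (sortedFibres hX)]
    exact congrArg (fun t => tuple a t ⋙ A.mul (sorted (f ≫ g)) (sortedFibres hX)) (funext h4)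
  have h6 : A.act n.mono (perm (tip (f ≫ g)) * (perm f)⁻¹ * (perm q)⁻¹) ⋙
      A.act n.mono (perm (tip (f ≫ g)))⁻¹ = A.act n.mono (perm q)⁻¹ ⋙ A.act n.mono (perm f)⁻¹ := by
    rw [← A.act_mul, ← A.act_mul]
    congr 1
    group
  calc _ = (tuple ((tuple a b ⋙ A.mul (sorted g) (sortedFibres hY)) ⋙ A.act _ (perm g)⁻¹) c ⋙
        A.mul (sorted f) (sortedFibres hZ)) ⋙ A.act n.mono (perm f)⁻¹ := rfl
    _ = (tuple (tuple a b ⋙ A.mul (sorted g) (sortedFibres hY)) (fun j => c ((perm g)⁻¹ j)) ⋙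
      A.mul (sorted q) hqZ) ⋙ A.act n.mono (perm q)⁻¹ ⋙ A.act n.mono (perm f)⁻¹ :=
        congrArg (· ⋙ A.act n.mono (perm f)⁻¹) h1
    _ = _ := by
      rw [h5, ← h6]
      exact congrArg (· ⋙ A.act n.mono (perm (tip (f ≫ g)))⁻¹) h3.symm

/-- The operad over finite ordinals and all maps that corresponds to a left symmetric operad. -/
def toSObj : CatOperad.{v, u} OmegaS where
  obj n := A.obj n.mono
  unit := A.unit
  mul σ _ hF := A.toSMul σ hF
  assoc f g _ _ _ hX hY hZ τ hτ hW E a b c := A.toS_assoc f g hX hY hZ τ hτ hW E a b c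
  mul_id {n} hF E a := by
    have hF' : Fibres (𝟙 n.mono) fun _ => (pt : OmegaMono) :=
      ⟨fun i => ⟨tip (hF.incl i), (hF.isFibre i).1.monotone⟩, hF.isFibre⟩
    rw [A.toSMul_of_monotone (𝟙 n) hF (𝟙 n.mono) (fun _ => rfl) hF']
    exact A.mul_id hF' E a
  id_mul {n} σ hF E a := by
    let τ : n.mono ⟶ (pt : OmegaMono) :=
      (⟨σ, fun _ _ _ => (Subsingleton.elim (α := Fin 1) _ _).le⟩ : Fin n.size →o Fin 1)
    have hF' : Fibres τ fun _ => n.mono :=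
      ⟨fun i => ⟨tip (hF.incl i), (hF.isFibre i).1.monotone⟩, hF.isFibre⟩
    rw [A.toSMul_of_monotone σ hF τ (fun _ => rfl) hF']
    exact A.id_mul τ hF' E a

end SymOperad

namespace SymOperad

/-- Morphisms of left symmetric categorical operads: operadic functors that strictly commute
with the symmetric group actions. -/
@[ext]
structure SymFunctor (A B : SymOperad.{v, u}) extends
    OpFunctor A.toCatOperad B.toCatOperad where
  act : ∀ (n : OmegaMono) (π : Equiv.Perm (Fin n.size)),
    A.act n π ⋙ functor n = functor n ⋙ B.act n π

theorem SymFunctor.act_obj {A B : SymOperad.{v, u}} (Φ : SymFunctor A B) {n : OmegaMono}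
    (π : Equiv.Perm (Fin n.size)) (x : A.obj n) :
    (Φ.functor n).obj ((A.act n π).obj x) = (B.act n π).obj ((Φ.functor n).obj x) :=
  Functor.congr_obj (Φ.act n π) x

theorem SymFunctor.act_map {A B : SymOperad.{v, u}} (Φ : SymFunctor A B) {n : OmegaMono}
    (π : Equiv.Perm (Fin n.size)) {x y : A.obj n} (f : x ⟶ y) :
    (Φ.functor n).map ((A.act n π).map f) = eqToHom (Φ.act_obj π x) ≫
      (B.act n π).map ((Φ.functor n).map f) ≫ eqToHom (Φ.act_obj π y).symm :=
  Functor.congr_hom (Φ.act n π) f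

/-- Operadic natural transformations compatible with the symmetric group actions. -/
structure SymTrans {A B : SymOperad.{v, u}} (Φ Ψ : SymFunctor A B) extends
    OpTrans Φ.toOpFunctor Ψ.toOpFunctor where
  act : ∀ (n : OmegaMono) (π : Equiv.Perm (Fin n.size)) (x : A.obj n),
    (app n).app ((A.act n π).obj x) =
      eqToHom (Φ.act_obj π x) ≫ (B.act n π).map ((app n).app x) ≫
        eqToHom (Ψ.act_obj π x).symm

theorem SymTrans.ext {A B : SymOperad.{v, u}} {Φ Ψ : SymFunctor A B} {α β : SymTrans Φ Ψ}
    (h : α.toOpTrans = β.toOpTrans) : α = β := by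
  cases α; cases β; cases h; rfl

def SymTrans.id {A B : SymOperad.{v, u}} (Φ : SymFunctor A B) : SymTrans Φ Φ where
  toOpTrans := 𝟙 Φ.toOpFunctor
  act n π x := by
    change 𝟙 _ = eqToHom _ ≫ (B.act n π).map (𝟙 _) ≫ eqToHom _
    simp

def SymTrans.comp {A B : SymOperad.{v, u}} {Φ Ψ Θ : SymFunctor A B} (α : SymTrans Φ Ψ)
    (β : SymTrans Ψ Θ) : SymTrans Φ Θ where
  toOpTrans := (show Φ.toOpFunctor ⟶ Ψ.toOpFunctor from α.toOpTrans) ≫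
    (show Ψ.toOpFunctor ⟶ Θ.toOpFunctor from β.toOpTrans)
  act n π x := by
    change (α.app n).app _ ≫ (β.app n).app _ = eqToHom _ ≫ (B.act n π).map
      ((α.app n).app x ≫ (β.app n).app x) ≫ eqToHom _
    simp only [α.act, β.act, Category.assoc, Functor.map_comp,
      eqToHom_trans_assoc, eqToHom_refl, Category.id_comp]

instance homCategory (A B : SymOperad.{v, u}) : Category (SymFunctor A B) where
  Hom Φ Ψ := SymTrans Φ Ψ
  id Φ := SymTrans.id Φ
  comp α β := SymTrans.comp α β
  id_comp {Φ Ψ} α := SymTrans.ext (Category.id_comp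
    (show Φ.toOpFunctor ⟶ Ψ.toOpFunctor from α.toOpTrans))
  comp_id {Φ Ψ} α := SymTrans.ext (Category.comp_id
    (show Φ.toOpFunctor ⟶ Ψ.toOpFunctor from α.toOpTrans))
  assoc {Φ Ψ Θ Ξ} α β γ := SymTrans.ext (Category.assoc
    (show Φ.toOpFunctor ⟶ Ψ.toOpFunctor from α.toOpTrans)
    (show Ψ.toOpFunctor ⟶ Θ.toOpFunctor from β.toOpTrans)
    (show Θ.toOpFunctor ⟶ Ξ.toOpFunctor from γ.toOpTrans))

theorem hom₂_ext {A B : SymOperad.{v, u}} {Φ Ψ : SymFunctor A B} {α β : Φ ⟶ Ψ}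
    (h : ∀ n, α.app n = β.app n) : α = β :=
  SymTrans.ext (CatOperad.hom₂_ext h)

def SymFunctor.id (A : SymOperad.{v, u}) : SymFunctor A A :=
  ⟨OpFunctor.id A.toCatOperad, fun _ _ => rfl⟩

def SymFunctor.comp {A B D : SymOperad.{v, u}} (Φ : SymFunctor A B) (Ψ : SymFunctor B D) :
    SymFunctor A D :=
  ⟨Φ.toOpFunctor.comp Ψ.toOpFunctor, fun n π => by
    change A.act n π ⋙ Φ.functor n ⋙ Ψ.functor n = (Φ.functor n ⋙ Ψ.functor n) ⋙ D.act n π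
    rw [← Functor.assoc, Φ.act n π, Functor.assoc, Ψ.act n π, Functor.assoc]⟩

def whiskerLeft {A B D : SymOperad.{v, u}} (Φ : SymFunctor A B) {Ψ Θ : SymFunctor B D}
    (α : Ψ ⟶ Θ) : Φ.comp Ψ ⟶ Φ.comp Θ :=
  ⟨CatOperad.whiskerLeft Φ.toOpFunctor (Ψ := Ψ.toOpFunctor) (Θ := Θ.toOpFunctor) α.toOpTrans,
    fun n π x => by
      refine (app_eqToHom (α.app _) (Φ.act_obj π x)).trans ?_
      rw [α.act]
      simp only [Category.assoc, eqToHom_trans, eqToHom_trans_assoc]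
      rfl⟩

def whiskerRight {A B D : SymOperad.{v, u}} {Φ Ψ : SymFunctor A B} (α : Φ ⟶ Ψ)
    (Θ : SymFunctor B D) : Φ.comp Θ ⟶ Ψ.comp Θ :=
  ⟨CatOperad.whiskerRight (Φ := Φ.toOpFunctor) (Ψ := Ψ.toOpFunctor) α.toOpTrans Θ.toOpFunctor,
    fun n π x => by
      simp only [CatOperad.whiskerRight, Functor.whiskerRight_app, α.act, Functor.map_comp,
        eqToHom_map, Θ.act_map, Category.assoc, eqToHom_trans, eqToHom_trans_assoc]
      rfl⟩

/-- The (strict) 2-category of left symmetric categorical operads. -/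
instance bicategory : Bicategory SymOperad.{v, u} where
  Hom A B := SymFunctor A B
  id A := SymFunctor.id A
  comp Φ Ψ := Φ.comp Ψ
  homCategory A B := homCategory A B
  whiskerLeft Φ _ _ α := whiskerLeft Φ α
  whiskerRight α Θ := whiskerRight α Θ
  associator Φ Ψ Θ := Iso.refl (Φ.comp (Ψ.comp Θ))
  leftUnitor Φ := Iso.refl Φ
  rightUnitor Φ := Iso.refl Φ
  whiskerLeft_id _ _ := rfl
  whiskerLeft_comp _ _ _ _ _ _ := rfl
  id_whiskerLeft α := ((Category.id_comp _).trans (Category.comp_id _)).symm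
  comp_whiskerLeft _ _ _ _ α := ((Category.id_comp _).trans (Category.comp_id _)).symm
  id_whiskerRight _ Ψ := hom₂_ext fun _ => NatTrans.ext (funext fun _ => CategoryTheory.Functor.map_id _ _)
  comp_whiskerRight _ _ Ψ := hom₂_ext fun _ => NatTrans.ext (funext fun _ => Functor.map_comp _ _ _)
  whiskerRight_id α := ((Category.id_comp _).trans (Category.comp_id _)).symm
  whiskerRight_comp α _ _ := ((Category.id_comp _).trans (Category.comp_id _)).symm
  whisker_assoc _ _ _ _ _ := ((Category.id_comp _).trans (Category.comp_id _)).symm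
  whisker_exchange α β := hom₂_ext fun _ => NatTrans.ext (funext fun _ =>
    ((β.app _).naturality _).symm)
  pentagon _ _ _ Θ := by
    refine hom₂_ext fun _ => NatTrans.ext (funext fun _ => ?_)
    change (Θ.functor _).map (𝟙 _) ≫ 𝟙 _ ≫ 𝟙 _ = 𝟙 _ ≫ 𝟙 _
    simp
  triangle _ Ψ := by
    refine hom₂_ext fun _ => NatTrans.ext (funext fun _ => ?_)
    change 𝟙 _ ≫ 𝟙 _ = (Ψ.functor _).map (𝟙 _)
    simp

instance strict : Bicategory.Strict SymOperad.{v, u} where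
  id_comp _ := rfl
  comp_id _ := rfl
  assoc _ _ _ := rfl
  leftUnitor_eqToIso _ := rfl
  rightUnitor_eqToIso _ := rfl
  associator_eqToIso _ _ _ := rfl

def toSMap {A B : SymOperad.{v, u}} (Φ : SymFunctor A B) : A.toSObj.OpFunctor B.toSObj where
  functor n := Φ.functor n.mono
  mul {n k} σ F hF := by
    change (A.mul _ _ ⋙ A.act n.mono _) ⋙ Φ.functor n.mono = _ ⋙ B.mul _ _ ⋙ B.act n.mono _
    rw [Functor.assoc, Φ.act, ← Functor.assoc, Φ.mul]
    rfl
  unit := Φ.unit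

theorem conj_map {X Y : Type*} [Category* X] [Category* Y] (G : X ⥤ Y) {x y z w : X}
    {f : x ⟶ w} {g : y ⟶ z} {h : x = y} {h' : z = w} (e : f = eqToHom h ≫ g ≫ eqToHom h')
    {s t : Y} (p : s = G.obj x) (q : G.obj w = t) (p' : s = G.obj y) (q' : G.obj z = t) :
    eqToHom p ≫ G.map f ≫ eqToHom q = eqToHom p' ≫ G.map g ≫ eqToHom q' := by
  subst h h' e
  simp

def toSMap₂ {A B : SymOperad.{v, u}} {Φ Ψ : SymFunctor A B} (α : Φ ⟶ Ψ) :
    toSMap Φ ⟶ toSMap Ψ where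
  app n := α.app n.mono
  mul {n k} σ F hF x y := by
    refine (α.act n.mono (OmegaS.perm (tip σ))⁻¹ _).trans ?_
    exact conj_map (B.act n.mono (OmegaS.perm (tip σ))⁻¹)
      (α.mul (OmegaS.sorted σ) (OmegaS.sortedFibres hF) x y) _ _ _ _
  unit := α.unit

/-- `toSObj` as a 2-functor. -/
def toS : StrictPseudofunctor SymOperad.{v, u} (CatOperad.{v, u} OmegaS) :=
  StrictPseudofunctor.mk''
    { obj := toSObj
      map := fun Φ => toSMap Φ
      map₂ := fun α => toSMap₂ α
      map₂_id := fun _ => rfl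
      map₂_comp := fun _ _ => rfl
      map_id := fun _ => rfl
      map_comp := fun _ _ => rfl
      map₂_whisker_left := fun _ _ _ _ => ((Category.id_comp _).trans (Category.comp_id _)).symm
      map₂_whisker_right := fun _ _ => ((Category.id_comp _).trans (Category.comp_id _)).symm }

end SymOperad

namespace NTree

variable {n : ℕ}

abbrev tips (T : NTree n) : OmegaS := ⟨T.card⟩

def tipsHom {T S : NTree n} (σ : T ⟶ S) : T.tips ⟶ S.tips := tip σ

def tipsFibres {T S : NTree n} {σ : T ⟶ S} {F : Fin S.card → NTree n} (hF : Fibres σ F) :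
    Fibres (tipsHom σ) fun i => (F i).tips where
  incl i := tip (hF.incl i)
  isFibre i := by
    obtain ⟨ξ, h, hξ⟩ := hF.isFibre i
    have := hξ (Fin.last n)
    rw [h] at this
    exact this

end NTree

namespace CatOperad

open NTree

variable {n : ℕ}

/-- An operad over finite ordinals and all maps gives an `n`-operad with
`obj T = A.obj (tips of T)`. Applied to `toSObj A`, it is the desymmetrisation of the left
symmetric operad `A`. -/
def restrictObj (n : ℕ) (A : CatOperad.{v, u} OmegaS) : CatOperad.{v, u} (NTree n) where
  obj T := A.obj T.tips
  unit := A.unit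
  mul σ _ hF := A.mul (tipsHom σ) (tipsFibres hF)
  assoc σ ω X Y Z hX hY hZ τ hτ hW E a b c :=
    A.assoc (X := fun i => (X i).tips) (Y := fun i => (Y i).tips) (Z := fun i => (Z i).tips)
      (tipsHom σ) (tipsHom ω) (tipsFibres hX) (tipsFibres hY) (tipsFibres hZ)
      (fun i => tipsHom (τ i)) (fun i => congrArg (fun f => tip f) (hτ i))
      (fun i => tipsFibres (hW i)) E a b c
  mul_id {T} hF E a := A.mul_id (tipsFibres hF) E a
  id_mul {T} σ hF E a := A.id_mul (tipsHom σ) (tipsFibres hF) E a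

def restrictMap {A B : CatOperad.{v, u} OmegaS} (Φ : A.OpFunctor B) :
    (restrictObj n A).OpFunctor (restrictObj n B) where
  functor T := Φ.functor T.tips
  mul σ _ hF := Φ.mul (tipsHom σ) (tipsFibres hF)
  unit := Φ.unit

def restrictMap₂ {A B : CatOperad.{v, u} OmegaS} {Φ Ψ : A.OpFunctor B} (α : Φ ⟶ Ψ) :
    restrictMap (n := n) Φ ⟶ restrictMap Ψ where
  app T := α.app T.tips
  mul σ _ hF x y := α.mul (tipsHom σ) (tipsFibres hF) x y
  unit := α.unit

/-- `restrictObj` as a 2-functor. -/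
def restrict (n : ℕ) : StrictPseudofunctor (CatOperad.{v, u} OmegaS) (CatOperad.{v, u} (NTree n)) :=
  StrictPseudofunctor.mk''
    { obj := restrictObj n
      map := fun Φ => restrictMap Φ
      map₂ := fun α => restrictMap₂ α
      map₂_id := fun _ => rfl
      map₂_comp := fun _ _ => rfl
      map_id := fun _ => rfl
      map_comp := fun _ _ => rfl
      map₂_whisker_left := fun _ _ _ _ => ((Category.id_comp _).trans (Category.comp_id _)).symm
      map₂_whisker_right := fun _ _ => ((Category.id_comp _).trans (Category.comp_id _)).symm }

end CatOperad

namespace InternalOperad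

open NTree CatOperad

/-- The restriction of internal operads along the functor from trees to their sets of tips. -/
def restrict (n : ℕ) (A : CatOperad.{v, u} OmegaS) :
    InternalOperad A ⥤ InternalOperad (restrictObj n A) where
  obj a :=
    { obj := fun T => a.obj T.tips
      mul := fun σ _ hF => a.mul (tipsHom σ) (tipsFibres hF)
      unit := a.unit
      assoc := fun {_ _ _} σ ω {X Y Z} hX hY hZ τ hτ hW =>
        a.assoc (X := fun i => (X i).tips) (Y := fun i => (Y i).tips) (Z := fun i => (Z i).tips)
          (tipsHom σ) (tipsHom ω) (tipsFibres hX) (tipsFibres hY) (tipsFibres hZ)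
          (fun i => tipsHom (τ i)) (fun i => congrArg (fun f => tip f) (hτ i))
          (fun i => tipsFibres (hW i))
      mul_id := fun hF => a.mul_id (tipsFibres hF)
      id_mul := fun σ hF => a.id_mul (tipsHom σ) (tipsFibres hF) }
  map f :=
    { app := fun T => f.app T.tips
      mul := fun σ _ hF => f.mul (tipsHom σ) (tipsFibres hF)
      unit := f.unit }

end InternalOperad

/-- `IntOpSym n A` is the category of internal `n`-operads in the left symmetric categorical operad
`A`, that is, of internal `n`-operads in the desymmetrisation of `A`. For `n = ∞` it is the
category of internal symmetric operads, with multiplications indexed by all maps `[n] ⟶ [k]`. -/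
def IntOpSym : ℕ∞ → StrictPseudofunctor SymOperad.{v, u} Cat.{v, max v u}
  | none => SymOperad.toS.comp (IntOp OmegaS)
  | some n => (SymOperad.toS.comp (CatOperad.restrict n)).comp (IntOp (NTree n))

/-- Internal desymmetrisation: an internal symmetric operad `a` is sent to the internal
`n`-operad `T ↦ a (tips of T)`. For `n = ∞` it is the identity. -/
def delta : (n : ℕ∞) → (A : SymOperad.{v, u}) → ((IntOpSym ⊤).obj A ⥤ (IntOpSym n).obj A)
  | none, A => 𝟭 (InternalOperad A.toSObj)
  | some n, A => InternalOperad.restrict n A.toSObj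

theorem delta_map_obj (n : ℕ∞) {A B : SymOperad.{v, u}} (f : A ⟶ B) (x : (IntOpSym ⊤).obj A) :
    (delta n B).obj (((IntOpSym ⊤).map f).toFunctor.obj x) =
      ((IntOpSym n).map f).toFunctor.obj ((delta n A).obj x) := by
  cases n <;> rfl

/-- `h` represents the 2-functor `G`: isomorphisms of categories `B(h, A) ≅ G A`, natural with
respect to 1-morphisms and 2-morphisms in `A`. -/
structure Represents {B : Type*} [Bicategory B] [Bicategory.Strict B]
    (G : StrictPseudofunctor B Cat.{v, u}) (h : B) where
  hom : ∀ A, (h ⟶ A) ⥤ G.obj A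
  inv : ∀ A, G.obj A ⥤ (h ⟶ A)
  hom_inv : ∀ A, hom A ⋙ inv A = 𝟭 (h ⟶ A)
  inv_hom : ∀ A, inv A ⋙ hom A = 𝟭 (G.obj A)
  naturality : ∀ {A D : B} (f : A ⟶ D),
    Bicategory.postcomp h f ⋙ hom D = hom A ⋙ (G.map f).toFunctor
  naturality₂ : ∀ {A D : B} {f g : A ⟶ D} (α : f ⟶ g) (x : h ⟶ A),
    (hom D).map (Bicategory.whiskerLeft x α) =
      eqToHom (Functor.congr_obj (naturality f) x) ≫ (G.map₂ α).toNatTrans.app ((hom A).obj x) ≫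
        eqToHom (Functor.congr_obj (naturality g) x).symm

namespace Represents

/-- The canonical morphism `ζ : h^n ⟶ H^∞`: it corresponds to the internal desymmetrisation of
the universal internal symmetric operad of `H^∞`. -/
def zeta {n : ℕ∞} {h H : SymOperad.{v, u}} (rh : Represents (IntOpSym n) h)
    (rH : Represents (IntOpSym ⊤) H) : h ⟶ H :=
  (rh.inv H).obj ((delta n H).obj ((rH.hom H).obj (𝟙 H)))

theorem hom_inv_obj {B : Type*} [Bicategory B] [Bicategory.Strict B]
    {G : StrictPseudofunctor B Cat.{v, u}} {h : B} (r : Represents G h) {A : B}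
    (a : G.obj A) : (r.hom A).obj ((r.inv A).obj a) = a :=
  Functor.congr_obj (r.inv_hom A) a

/-- Restriction along `ζ` corresponds to internal desymmetrisation. -/
theorem hom_zeta_comp {n : ℕ∞} {h H : SymOperad.{v, u}} (rh : Represents (IntOpSym n) h)
    (rH : Represents (IntOpSym ⊤) H) {A : SymOperad.{v, u}} (x : H ⟶ A) :
    (rh.hom A).obj (rh.zeta rH ≫ x) = (delta n A).obj ((rH.hom A).obj x) := by
  refine (Functor.congr_obj (rh.naturality x) (rh.zeta rH)).trans ?_
  refine (congrArg ((IntOpSym n).map x).toFunctor.obj (rh.hom_inv_obj _)).trans ?_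
  refine (delta_map_obj n x _).symm.trans ?_
  exact congrArg (delta n A).obj (Functor.congr_obj (rH.naturality x) (𝟙 H)).symm

/-- The case `x = rH.inv b` of `hom_zeta_comp`. -/
theorem hom_zeta_comp_inv {n : ℕ∞} {h H : SymOperad.{v, u}} (rh : Represents (IntOpSym n) h)
    (rH : Represents (IntOpSym ⊤) H) {A : SymOperad.{v, u}} (b : (IntOpSym ⊤).obj A) :
    (rh.hom A).obj (rh.zeta rH ≫ (rH.inv A).obj b) = (delta n A).obj b :=
  (rh.hom_zeta_comp rH _).trans (congrArg (delta n A).obj (rH.hom_inv_obj b))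

end Represents

end HigherOperad

open HigherOperad

/-! All the representing operads come from one construction of a free operad as syntax modulo
semantics. The generators are one object for each arity (an object of the index category) and one
morphism for each structure map of an internal operad. Objects are formal operadic expressions in
the generators; morphisms are formal composites of the generating morphisms, of products and
permutations of morphisms, and of identifications. A model is an actual operad `A`; its parameter is
an internal operad in `A`, and each expression evaluates to a functor of the parameter. Two
expressions, or two parallel formal composites, are identified exactly when they have equal values
in every model.

The strict laws of the free operad therefore need no rewriting theory: each law is an equation
between generalised elements, values in models separate these (`functor_ext`), and there the law is
that of `A` (`mulFunctor_assoc`, `mulFunctor_permFunctor_outer`, ...). Although the models form a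
large family, the quotient is one of a small set of expressions, so the free operad stays in the
given universes.

Evaluation at an internal operad `a` is an operadic functor (`evalOp`), and evaluation along a
morphism of internal operads is an operadic transformation (`evalTrans`). Conversely, every
expression and every formal composite is built from generators by operations that operadic functors
preserve, so induction gives uniqueness (`eq_evalOp`, `opTrans_ext`). The generators form an
internal operad because evaluations are jointly faithful and carry its equations to those of each
`a` (`ofJointlyFaithful`). This is a universal element, and a Yoneda argument (`ofUniversal`) turns
it into a representation. In the symmetric cases permutations are added as unary operations and the
models are the symmetric operads.

The Kan extension is formal. The isomorphisms of categories turn whiskering with `ζ` into internal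
desymmetrisation, on 2-cells as well (`hom_zeta_whiskerLeft`). Hence a 2-cell from `ã` to `ζ ≫ t` is
a morphism from `a` to the desymmetrisation of the internal operad of `t`, and the required
factorisation through the unit is the bijection of the adjunction (`exists_unique_desc`). -/

namespace HigherOperad

open FibreCat CatOperad

universe w w'

/-! ### The laws of operads on generalised elements of arbitrary size -/

namespace CatOperad

variable {C : Type} [FibreCat C] (A : CatOperad.{v, u} C)

/-- The laws are given only for `E` in `Cat.{v, u}`, whereas the values of expressions are functors
on categories `E × Param` of possibly other size. It suffices to take the law at the product of all
arguments, with the projections as generalised elements, and to precompose; the other laws below are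
extended in the same way. -/
theorem assoc_of_large {T S R : C} (σ : T ⟶ S) (ω : S ⟶ R) {X Y : Fin (card R) → C}
    {Z : Fin (card S) → C} (hX : Fibres (σ ≫ ω) X) (hY : Fibres ω Y) (hZ : Fibres σ Z)
    (τ : ∀ i, X i ⟶ Y i) (hτ : ∀ i, τ i ≫ hY.incl i = hX.incl i ≫ σ)
    (hW : ∀ i, Fibres (τ i) fun j => Z (tip (hY.incl i) j))
    {E : Type*} [Category* E] (a : E ⥤ A.obj R) (b : ∀ i, E ⥤ A.obj (Y i))
    (c : ∀ j, E ⥤ A.obj (Z j)) :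
    tuple (tuple a b ⋙ A.mul ω hY) c ⋙ A.mul σ hZ =
      tuple a (fun i => tuple (b i) (fun j => c (tip (hY.incl i) j)) ⋙ A.mul (τ i) (hW i)) ⋙
        A.mul (σ ≫ ω) hX :=
  congrArg (fun P => (a.prod' ((Functor.pi' b).prod' (Functor.pi' c))) ⋙ P)
    (A.assoc σ ω hX hY hZ τ hτ hW
      (Cat.of (A.obj R × (∀ i, A.obj (Y i)) × (∀ j, A.obj (Z j))))
      (CategoryTheory.Prod.fst _ _)
      (fun i => CategoryTheory.Prod.snd _ _ ⋙ CategoryTheory.Prod.fst _ _ ⋙ Pi.eval _ i)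
      (fun j => CategoryTheory.Prod.snd _ _ ⋙ CategoryTheory.Prod.snd _ _ ⋙ Pi.eval _ j))

theorem mul_id_of_large {T : C} (hF : Fibres (𝟙 T) fun _ => pt) {E : Type*} [Category* E]
    (a : E ⥤ A.obj T) :
    tuple a (fun _ => (Functor.const E).obj A.unit) ⋙ A.mul (𝟙 T) hF = a :=
  congrArg (fun P => a ⋙ P) (A.mul_id hF (A.obj T) (𝟭 _))

theorem id_mul_of_large {T : C} (σ : T ⟶ pt) (hF : Fibres σ fun _ => T) {E : Type*}
    [Category* E] (a : E ⥤ A.obj T) :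
    tuple ((Functor.const E).obj A.unit) (fun _ => a) ⋙ A.mul σ hF = a :=
  congrArg (fun P => a ⋙ P) (A.id_mul σ hF (A.obj T) (𝟭 _))

end CatOperad

namespace SymOperad

variable (A : SymOperad.{v, u})

theorem mul_act_of_large {n k : OmegaMono} (σ σ' : n ⟶ k) (ρ : Equiv.Perm (Fin k.size))
    (π : Equiv.Perm (Fin n.size)) (h : ∀ x, ρ (tip σ' x) = tip σ (π x))
    (h' : ∀ x y, tip σ' x = tip σ' y → x ≤ y → π x ≤ π y)
    {d : Fin k.size → OmegaMono} (hd : Fibres σ d) (hd' : Fibres σ' fun i => d (ρ i))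
    {E : Type*} [Category* E] (a : E ⥤ A.obj k) (b : ∀ i, E ⥤ A.obj (d i)) :
    tuple (a ⋙ A.act k ρ) b ⋙ A.mul σ hd =
      tuple a (fun i => b (ρ i)) ⋙ A.mul σ' hd' ⋙ A.act n π :=
  congrArg (fun P => (a.prod' (Functor.pi' b)) ⋙ P)
    (A.mul_act σ σ' ρ π h h' hd hd' (Cat.of (A.obj k × (∀ i, A.obj (d i))))
      (CategoryTheory.Prod.fst _ _) (fun i => CategoryTheory.Prod.snd _ _ ⋙ Pi.eval _ i))

theorem mul_act_fibre_of_large {n k : OmegaMono} (σ : n ⟶ k) (π : Equiv.Perm (Fin n.size))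
    {d : Fin k.size → OmegaMono} (hd : Fibres σ d) (θ : ∀ i, Equiv.Perm (Fin (d i).size))
    (h : ∀ i x, tip (hd.incl i) (θ i x) = π (tip (hd.incl i) x))
    {E : Type*} [Category* E] (a : E ⥤ A.obj k) (b : ∀ i, E ⥤ A.obj (d i)) :
    tuple a (fun i => b i ⋙ A.act (d i) (θ i)) ⋙ A.mul σ hd =
      tuple a b ⋙ A.mul σ hd ⋙ A.act n π :=
  congrArg (fun P => (a.prod' (Functor.pi' b)) ⋙ P)
    (A.mul_act_fibre σ π hd θ h (Cat.of (A.obj k × (∀ i, A.obj (d i))))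
      (CategoryTheory.Prod.fst _ _) (fun i => CategoryTheory.Prod.snd _ _ ⋙ Pi.eval _ i))

end SymOperad

/-! ### Terms and their evaluation -/

section Terms

variable {C : Type} [FibreCat C]

/-- Operadic expressions in generators `d : D` of arity `ar d` and unary operations `op`. -/
inductive Term (op : C → Type) {D : Type} (ar : D → C) : C → Type
  | gen (d : D) : Term op ar (ar d)
  | unit : Term op ar pt
  | mul {T S : C} (σ : T ⟶ S) {F : Fin (card S) → C} (hF : Fibres σ F) (x : Term op ar S)
      (y : ∀ i, Term op ar (F i)) : Term op ar T
  | act {T : C} (p : op T) (x : Term op ar T) : Term op ar T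

/-- A categorical operad with unary operations, and a family of interpretations of the generators
which depends functorially on a parameter. -/
structure Model (op : C → Type) {D : Type} (ar : D → C) where
  operad : CatOperad.{v, u} C
  act : ∀ {T : C}, op T → (operad.obj T ⥤ operad.obj T)
  Param : Type w
  [category : Category.{v} Param]
  gen : ∀ d, Param ⥤ operad.obj (ar d)

attribute [instance] Model.category

variable {op : C → Type} {D : Type} {ar : D → C}

/-- The value of an expression in a model, as a functor of the parameter. -/
def Model.eval (M : Model.{v, u, w} op ar) : ∀ {T : C}, Term op ar T → (M.Param ⥤ M.operad.obj T)
  | _, .gen d => M.gen d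
  | _, .unit => (Functor.const _).obj M.operad.unit
  | _, .mul σ hF x y => tuple (M.eval x) (fun i => M.eval (y i)) ⋙ M.operad.mul σ hF
  | _, .act p x => M.eval x ⋙ M.act p

end Terms

/-- A natural transformation between tuples of functors, given by its components. -/
@[simps]
def tupleTrans {E X : Type*} [Category* E] [Category* X] {k : ℕ} {Y : Fin k → Type*}
    [∀ i, Category* (Y i)] {x x' : E ⥤ X} {y y' : ∀ i, E ⥤ Y i} (f : x ⟶ x')
    (g : ∀ i, y i ⟶ y' i) : tuple x y ⟶ tuple x' y' where
  app e := Prod.mkHom (f.app e) fun i => (g i).app e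
  naturality _ _ t := Prod.ext (f.naturality t) (funext fun i => (g i).naturality t)

/-- Generators, unary operations and generating morphisms, together with a class of models. -/
structure Presentation (C : Type) [FibreCat C] where
  op : C → Type
  Gen : Type
  ar : Gen → C
  Index : Type w'
  model : Index → Model.{v, u, w} op ar
  Cell : C → Type
  src : ∀ {T : C}, Cell T → Term op ar T
  tgt : ∀ {T : C}, Cell T → Term op ar T
  interp : ∀ (b : Index) {T : C} (j : Cell T), (model b).eval (src j) ⟶ (model b).eval (tgt j)

/-! ### The free operad of a presentation: expressions modulo equality of values -/

namespace Presentation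

variable {C : Type} [FibreCat C] (P : Presentation.{v, u, w, w'} C)

abbrev Expr (T : C) : Type := Term P.op P.ar T

/-- Expressions are identified if they have the same values in all models. -/
def Rel {T : C} (x y : P.Expr T) : Prop := ∀ b, (P.model b).eval x = (P.model b).eval y

/-- Formal composites of generating morphisms and of the identifications `Rel`. -/
inductive Mor : ∀ {T : C}, P.Expr T → P.Expr T → Type v
  | id {T : C} (x : P.Expr T) : Mor x x
  | comp {T : C} {x y z : P.Expr T} (f : Mor x y) (g : Mor y z) : Mor x z
  | mul {T S : C} (σ : T ⟶ S) {F : Fin (card S) → C} (hF : Fibres σ F) {x x' : P.Expr S}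
      {y y' : ∀ i, P.Expr (F i)} (f : Mor x x') (g : ∀ i, Mor (y i) (y' i)) :
      Mor (.mul σ hF x y) (.mul σ hF x' y')
  | act {T : C} (p : P.op T) {x y : P.Expr T} (f : Mor x y) : Mor (.act p x) (.act p y)
  | cell {T : C} (j : P.Cell T) : Mor (P.src j) (P.tgt j)
  | ofRel {T : C} {x y : P.Expr T} (h : P.Rel x y) : Mor x y

variable {P}

/-- A formal identification is a strict equality of values in each model, so it evaluates to an
equality morphism. -/
def Mor.eval (b : P.Index) : ∀ {T : C} {x y : P.Expr T}, P.Mor x y →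
    ((P.model b).eval x ⟶ (P.model b).eval y)
  | _, _, _, .id _ => 𝟙 _
  | _, _, _, .comp f g => f.eval b ≫ g.eval b
  | _, _, _, .mul σ hF f g =>
      Functor.whiskerRight (tupleTrans (f.eval b) fun i => (g i).eval b) ((P.model b).operad.mul σ hF)
  | _, _, _, .act p f => Functor.whiskerRight (f.eval b) ((P.model b).act p)
  | _, _, _, .cell j => P.interp b j
  | _, _, _, .ofRel h => eqToHom (h b)

variable (P)

def setoid (T : C) : Setoid (P.Expr T) where
  r := P.Rel
  iseqv := ⟨fun _ _ => rfl, fun h b => (h b).symm, fun h h' b => (h b).trans (h' b)⟩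

def homSetoid {T : C} (x y : P.Expr T) : Setoid (P.Mor x y) where
  r f g := ∀ b, f.eval b = g.eval b
  iseqv := ⟨fun _ _ => rfl, fun h b => (h b).symm, fun h h' b => (h b).trans (h' b)⟩

/-- The objects of the free operad. -/
structure Obj (T : C) : Type u where
  cls : Quotient (P.setoid T)

variable {P}

/-- A representing expression. -/
noncomputable def Obj.term {T : C} (X : P.Obj T) : P.Expr T := X.cls.out

def mkObj {T : C} (x : P.Expr T) : P.Obj T := ⟨Quotient.mk (P.setoid T) x⟩

theorem rel_term_mkObj {T : C} (x : P.Expr T) : P.Rel (mkObj x).term x :=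
  Quotient.exact (s := P.setoid T) (Quotient.out_eq _)

theorem mkObj_term {T : C} (X : P.Obj T) : mkObj X.term = X := by
  obtain ⟨X⟩ := X
  exact congrArg Obj.mk (Quotient.out_eq _)

theorem mkObj_eq {T : C} {x y : P.Expr T} (h : P.Rel x y) : mkObj x = mkObj y :=
  congrArg Obj.mk (Quotient.sound (s := P.setoid T) h)

theorem Obj.ext_of_rel {T : C} {X Y : P.Obj T} (h : P.Rel X.term Y.term) : X = Y := by
  rw [← mkObj_term X, ← mkObj_term Y, mkObj_eq h]

/-- Morphisms are classes of formal composites between the chosen representing expressions. This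
makes composition immediate; changes of representative are supplied by `Mor.ofRel`. -/
noncomputable instance (T : C) : Category.{v} (P.Obj T) where
  Hom X Y := Quotient (P.homSetoid X.term Y.term)
  id X := Quotient.mk _ (.id X.term)
  comp := Quotient.map₂ .comp fun _ _ h _ _ h' b => congrArg₂ (· ≫ ·) (h b) (h' b)
  id_comp := by
    rintro X Y ⟨f⟩
    exact Quotient.sound fun b => Category.id_comp _
  comp_id := by
    rintro X Y ⟨f⟩
    exact Quotient.sound fun b => Category.comp_id _
  assoc := by
    rintro X Y Z W ⟨f⟩ ⟨g⟩ ⟨h⟩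
    exact Quotient.sound fun b => Category.assoc _ _ _

/-- The value in a model, as a functor to functors of the parameter. -/
noncomputable def value (b : P.Index) (T : C) :
    P.Obj T ⥤ ((P.model b).Param ⥤ (P.model b).operad.obj T) where
  obj X := (P.model b).eval X.term
  map f := Quotient.lift (Mor.eval b)
    (fun m m' (h : ∀ b, m.eval b = m'.eval b) => h b) f
  map_id _ := rfl
  map_comp := by
    rintro X Y Z ⟨f⟩ ⟨g⟩
    rfl

/-- Joint faithfulness of the evaluations is built into the quotient `homSetoid`. -/
theorem hom_ext {T : C} {X Y : P.Obj T} {f g : X ⟶ Y}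
    (h : ∀ b, (value b T).map f = (value b T).map g) : f = g := by
  revert h
  refine Quotient.inductionOn₂ f g fun f g h => ?_
  exact Quotient.sound (s := P.homSetoid _ _) h

/-- The morphism represented by a formal composite. -/
noncomputable def mkHom {T : C} {X Y : P.Obj T} (m : P.Mor X.term Y.term) : X ⟶ Y :=
  Quotient.mk (P.homSetoid _ _) m

theorem value_mkHom (b : P.Index) {T : C} {X Y : P.Obj T} (m : P.Mor X.term Y.term) :
    (value b T).map (mkHom m) = m.eval b := rfl

theorem exists_mkHom {T : C} {X Y : P.Obj T} (f : X ⟶ Y) : ∃ m, mkHom m = f :=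
  Quotient.exists_rep f

theorem value_mkObj (b : P.Index) {T : C} (x : P.Expr T) :
    (value b T).obj (mkObj x) = (P.model b).eval x :=
  rel_term_mkObj x b

/-- The morphism between represented objects which is given by a formal composite. -/
noncomputable def homOfMor {T : C} {x y : P.Expr T} (m : P.Mor x y) : mkObj x ⟶ mkObj y :=
  mkHom (.comp (.ofRel (rel_term_mkObj x)) (.comp m (.ofRel fun b => (rel_term_mkObj y b).symm)))

theorem value_homOfMor (b : P.Index) {T : C} {x y : P.Expr T} (m : P.Mor x y) :
    (value b T).map (homOfMor m) =
      eqToHom (value_mkObj b x) ≫ m.eval b ≫ eqToHom (value_mkObj b y).symm := rfl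

/-- This reduces arbitrary morphisms to those of the form `homOfMor`, whose ends are free
expressions instead of chosen representatives, so that induction on formal composites becomes
possible. -/
theorem mkHom_eq {T : C} {X Y : P.Obj T} (m : P.Mor X.term Y.term) :
    mkHom m = eqToHom (mkObj_term X).symm ≫ homOfMor m ≫ eqToHom (mkObj_term Y) := by
  refine hom_ext fun b => ?_
  simp only [Functor.map_comp, eqToHom_map, value_homOfMor, value_mkHom, eqToHom_trans_assoc,
    Category.assoc, eqToHom_trans]
  exact ((Category.id_comp _).trans (Category.comp_id _)).symm

theorem homOfMor_id {T : C} (x : P.Expr T) : homOfMor (.id x) = 𝟙 (mkObj x) := by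
  refine hom_ext fun b => ?_
  rw [value_homOfMor]
  simp [Mor.eval]

theorem homOfMor_comp {T : C} {x y z : P.Expr T} (m : P.Mor x y) (m' : P.Mor y z) :
    homOfMor (.comp m m') = homOfMor m ≫ homOfMor m' := by
  refine hom_ext fun b => ?_
  simp [value_homOfMor, Mor.eval]

/-- The formal identifications create no new isomorphisms: in the free operad they are equality
morphisms. -/
theorem homOfMor_ofRel {T : C} {x y : P.Expr T} (h : P.Rel x y) :
    homOfMor (.ofRel h) = eqToHom (mkObj_eq h) := by
  refine hom_ext fun b => ?_
  simp [value_homOfMor, Mor.eval, eqToHom_map]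

/-- The value of a generalised element of the free operad in a model. -/
noncomputable def lift (b : P.Index) {T : C} {E : Type*} [Category* E] (x : E ⥤ P.Obj T) :
    E × (P.model b).Param ⥤ (P.model b).operad.obj T :=
  Functor.uncurry.obj (x ⋙ value b T)

/-- Expressions with the same values in all models have the same class, and likewise for formal
composites; so strict equality of functors into the free operad can be tested in the models. This is
how all strict laws are obtained. -/
theorem functor_ext {T : C} {E : Type*} [Category* E] {x y : E ⥤ P.Obj T}
    (h : ∀ b, lift b x = lift b y) : x = y := by
  have h' : ∀ b, x ⋙ value b T = y ⋙ value b T := fun b => Functor.uncurry_obj_injective (h b)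
  refine CategoryTheory.Functor.ext (fun e => Obj.ext_of_rel fun b => Functor.congr_obj (h' b) e)
    fun e e' f => hom_ext fun b => ?_
  simp only [Functor.map_comp, eqToHom_map]
  exact Functor.congr_hom (h' b) f

/-- A formal composite that represents a morphism. -/
noncomputable def rep {T : C} {X Y : P.Obj T} (f : X ⟶ Y) : P.Mor X.term Y.term :=
  Quotient.out (s := P.homSetoid _ _) f

theorem mkHom_rep {T : C} {X Y : P.Obj T} (f : X ⟶ Y) : mkHom (rep f) = f :=
  Quotient.out_eq f

theorem eval_rep (b : P.Index) {T : C} {X Y : P.Obj T} (f : X ⟶ Y) :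
    (rep f).eval b = (value b T).map f := by
  rw [← value_mkHom, mkHom_rep]

theorem value_mkObj_mul (b : P.Index) {T S : C} (σ : T ⟶ S) {F : Fin (card S) → C}
    (hF : Fibres σ F) (X : P.Obj S) (Y : ∀ i, P.Obj (F i)) (p : (P.model b).Param) :
    ((value b T).obj (mkObj (.mul σ hF X.term fun i => (Y i).term))).obj p =
      ((P.model b).operad.mul σ hF).obj
        (((value b S).obj X).obj p, fun i => ((value b (F i)).obj (Y i)).obj p) :=
  Functor.congr_obj (value_mkObj b _) p

theorem value_mkObj_act (b : P.Index) {T : C} (o : P.op T) (X : P.Obj T)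
    (p : (P.model b).Param) :
    ((value b T).obj (mkObj (.act o X.term))).obj p =
      ((P.model b).act o).obj (((value b T).obj X).obj p) :=
  Functor.congr_obj (value_mkObj b _) p

theorem value_homOfMor_mul (b : P.Index) {T S : C} (σ : T ⟶ S) {F : Fin (card S) → C}
    (hF : Fibres σ F) {X X' : P.Obj S} {Y Y' : ∀ i, P.Obj (F i)} (f : X ⟶ X')
    (g : ∀ i, Y i ⟶ Y' i) (p : (P.model b).Param) :
    ((value b T).map (homOfMor (.mul σ hF (rep f) fun i => rep (g i)))).app p =
      eqToHom (value_mkObj_mul b σ hF X Y p) ≫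
        ((P.model b).operad.mul σ hF).map
          (Prod.mkHom (((value b S).map f).app p) fun i => ((value b (F i)).map (g i)).app p) ≫
        eqToHom (value_mkObj_mul b σ hF X' Y' p).symm := by
  rw [value_homOfMor, NatTrans.comp_app, NatTrans.comp_app, eqToHom_app, eqToHom_app,
    ← eval_rep, show (fun i => ((value b (F i)).map (g i)).app p) =
      fun i => ((rep (g i)).eval b).app p from funext fun i => by rw [eval_rep]]
  rfl

theorem value_homOfMor_act (b : P.Index) {T : C} (o : P.op T) {X X' : P.Obj T} (f : X ⟶ X')
    (p : (P.model b).Param) :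
    ((value b T).map (homOfMor (.act o (rep f)))).app p =
      eqToHom (value_mkObj_act b o X p) ≫
        ((P.model b).act o).map (((value b T).map f).app p) ≫
        eqToHom (value_mkObj_act b o X' p).symm := by
  rw [value_homOfMor, NatTrans.comp_app, NatTrans.comp_app, eqToHom_app, eqToHom_app, ← eval_rep]
  rfl

/-! ### Multiplication and unary operations of the free operad, and their laws -/

/-- Objects and morphisms are multiplied through chosen representatives. The choices do no harm,
because functoriality is checked on values, where only the classes matter. -/
noncomputable def mulFunctor {T S : C} (σ : T ⟶ S) {F : Fin (card S) → C} (hF : Fibres σ F) :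
    P.Obj S × (∀ i, P.Obj (F i)) ⥤ P.Obj T where
  obj X := mkObj (.mul σ hF X.1.term fun i => (X.2 i).term)
  map f := homOfMor (.mul σ hF (rep f.1) fun i => rep (f.2 i))
  map_id X := by
    refine hom_ext fun b => NatTrans.ext (funext fun p => ?_)
    rw [value_homOfMor_mul]
    simp only [CategoryTheory.Functor.map_id, NatTrans.id_app]
    refine (congrArg (fun t => _ ≫ t ≫ _)
      (CategoryTheory.Functor.map_id ((P.model b).operad.mul σ hF) _)).trans ?_
    rw [Category.id_comp, eqToHom_trans, eqToHom_refl]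
  map_comp f g := by
    refine hom_ext fun b => NatTrans.ext (funext fun p => ?_)
    rw [Functor.map_comp, NatTrans.comp_app, value_homOfMor_mul, value_homOfMor_mul,
      value_homOfMor_mul]
    simp only [prod_comp, Pi.comp_apply, Functor.map_comp,
      NatTrans.comp_app, Category.assoc, eqToHom_trans_assoc, eqToHom_refl, Category.id_comp]
    rw [← Functor.map_comp_assoc]
    rfl

noncomputable def actFunctor {T : C} (o : P.op T) : P.Obj T ⥤ P.Obj T where
  obj X := mkObj (.act o X.term)
  map f := homOfMor (.act o (rep f))
  map_id X := by
    refine hom_ext fun b => NatTrans.ext (funext fun p => ?_)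
    rw [value_homOfMor_act]
    simp
  map_comp f g := by
    refine hom_ext fun b => NatTrans.ext (funext fun p => ?_)
    rw [Functor.map_comp, NatTrans.comp_app, value_homOfMor_act, value_homOfMor_act,
      value_homOfMor_act]
    simp

theorem mulFunctor_mkObj {T S : C} (σ : T ⟶ S) {F : Fin (card S) → C} (hF : Fibres σ F)
    (x : P.Expr S) (y : ∀ i, P.Expr (F i)) :
    (mulFunctor σ hF).obj (mkObj x, fun i => mkObj (y i)) = mkObj (.mul σ hF x y) :=
  mkObj_eq fun b => by
    simp only [Model.eval]
    rw [rel_term_mkObj x b, show (fun i => (P.model b).eval (mkObj (y i)).term) = _ from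
      funext fun i => rel_term_mkObj (y i) b]

theorem actFunctor_mkObj {T : C} (p : P.op T) (x : P.Expr T) :
    (actFunctor p).obj (mkObj x) = mkObj (.act p x) :=
  mkObj_eq fun b => by
    simp only [Model.eval]
    rw [rel_term_mkObj x b]

/-- A transport along an equality of functors is natural in the parameter, hence can be moved past a
parameter morphism. -/
theorem conj_comp_map {G X : Type*} [Category* G] [Category* X] {H K L M : G ⥤ X}
    {p p' : G} (h : H.obj p = K.obj p) (α : K.obj p ⟶ L.obj p) (h' : M = L) (s : p ⟶ p') :
    (eqToHom h ≫ α ≫ eqToHom (Functor.congr_obj h' p).symm) ≫ M.map s =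
      eqToHom h ≫ (α ≫ L.map s) ≫ eqToHom (Functor.congr_obj h' p').symm := by
  subst h'
  simp

/-- Evaluation turns the syntactic multiplication into that of the model, for generalised elements.
Together with `lift_act` and `lift_unit` it translates each law of the free operad into the law of
the model. -/
theorem lift_mul (b : P.Index) {T S : C} (σ : T ⟶ S) {F : Fin (card S) → C} (hF : Fibres σ F)
    {E : Type*} [Category* E] (x : E ⥤ P.Obj S) (y : ∀ i, E ⥤ P.Obj (F i)) :
    lift b (tuple x y ⋙ mulFunctor σ hF) =
      tuple (lift b x) (fun i => lift b (y i)) ⋙ (P.model b).operad.mul σ hF := by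
  refine CategoryTheory.Functor.ext
    (fun e => value_mkObj_mul b σ hF (x.obj e.1) (fun i => (y i).obj e.1) e.2) fun e e' f => ?_
  -- On a pair of morphisms the uncurried functor acts first by the value of the syntactic morphism
  -- and then by the parameter morphism; the two factors are merged by functoriality of the model's
  -- multiplication.
  refine (congrArg (· ≫ _) (value_homOfMor_mul b σ hF (x.map f.1) (fun i => (y i).map f.1)
    e.2)).trans ?_
  refine (conj_comp_map (H := (value b T).obj _)
    (K := tuple ((value b S).obj (x.obj e.1)) (fun i => (value b (F i)).obj ((y i).obj e.1)) ⋙ _)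
    (L := tuple ((value b S).obj (x.obj e'.1)) (fun i => (value b (F i)).obj ((y i).obj e'.1)) ⋙ _)
    _ _ (value_mkObj b _) f.2).trans ?_
  refine congrArg (fun t => eqToHom _ ≫ t ≫ eqToHom _) ?_
  exact (Functor.map_comp ((P.model b).operad.mul σ hF) _ _).symm

theorem lift_act (b : P.Index) {T : C} (o : P.op T)
    {E : Type*} [Category* E] (x : E ⥤ P.Obj T) :
    lift b (x ⋙ actFunctor o) = lift b x ⋙ (P.model b).act o := by
  refine CategoryTheory.Functor.ext
    (fun e => value_mkObj_act b o (x.obj e.1) e.2) fun e e' f => ?_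
  refine (congrArg (· ≫ _) (value_homOfMor_act b o (x.map f.1) e.2)).trans ?_
  refine (conj_comp_map (H := (value b T).obj _)
    (K := (value b T).obj (x.obj e.1) ⋙ (P.model b).act o)
    (L := (value b T).obj (x.obj e'.1) ⋙ (P.model b).act o)
    _ _ (value_mkObj b _) f.2).trans ?_
  refine congrArg (fun t => eqToHom _ ≫ t ≫ eqToHom _) ?_
  exact (Functor.map_comp ((P.model b).act o) _ _).symm

theorem lift_unit (b : P.Index) {E : Type*} [Category* E] :
    lift b ((Functor.const E).obj (mkObj (P := P) .unit)) =
      (Functor.const _).obj (P.model b).operad.unit := by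
  refine CategoryTheory.Functor.ext (fun e => Functor.congr_obj (value_mkObj b _) e.2)
    fun e e' f => ?_
  refine (Category.id_comp _).trans ?_
  exact Functor.congr_hom (value_mkObj b _) f.2

theorem mulFunctor_assoc {T S R : C} (σ : T ⟶ S) (ω : S ⟶ R) {X Y : Fin (card R) → C}
    {Z : Fin (card S) → C} (hX : Fibres (σ ≫ ω) X) (hY : Fibres ω Y) (hZ : Fibres σ Z)
    (τ : ∀ i, X i ⟶ Y i) (hτ : ∀ i, τ i ≫ hY.incl i = hX.incl i ≫ σ)
    (hW : ∀ i, Fibres (τ i) fun j => Z (tip (hY.incl i) j))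
    {E : Type*} [Category* E] (a : E ⥤ P.Obj R) (b : ∀ i, E ⥤ P.Obj (Y i))
    (c : ∀ j, E ⥤ P.Obj (Z j)) :
    tuple (tuple a b ⋙ mulFunctor ω hY) c ⋙ mulFunctor σ hZ =
      tuple a (fun i => tuple (b i) (fun j => c (tip (hY.incl i) j)) ⋙ mulFunctor (τ i) (hW i)) ⋙
        mulFunctor (σ ≫ ω) hX := by
  refine functor_ext fun i => ?_
  simp only [lift_mul]
  exact (P.model i).operad.assoc_of_large σ ω hX hY hZ τ hτ hW _ _ _

theorem mulFunctor_mul_id {T : C} (hF : Fibres (𝟙 T) fun _ => pt) {E : Type*} [Category* E]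
    (a : E ⥤ P.Obj T) :
    tuple a (fun _ => (Functor.const E).obj (mkObj .unit)) ⋙ mulFunctor (𝟙 T) hF = a := by
  refine functor_ext fun i => ?_
  simp only [lift_mul, lift_unit]
  exact (P.model i).operad.mul_id_of_large hF _

theorem mulFunctor_id_mul {T : C} (σ : T ⟶ pt) (hF : Fibres σ fun _ => T) {E : Type*}
    [Category* E] (a : E ⥤ P.Obj T) :
    tuple ((Functor.const E).obj (mkObj .unit)) (fun _ => a) ⋙ mulFunctor σ hF = a := by
  refine functor_ext fun i => ?_
  simp only [lift_mul, lift_unit]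
  exact (P.model i).operad.id_mul_of_large σ hF _

variable (P)

/-- The free categorical operad. -/
noncomputable def free : CatOperad.{v, u} C where
  obj T := Cat.of (P.Obj T)
  unit := mkObj .unit
  mul σ _ hF := mulFunctor σ hF
  assoc σ ω _ _ _ hX hY hZ τ hτ hW _ a b c := mulFunctor_assoc σ ω hX hY hZ τ hτ hW a b c
  mul_id hF _ a := mulFunctor_mul_id hF a
  id_mul σ hF _ a := mulFunctor_id_mul σ hF a

end Presentation
namespace Presentation

variable {C : Type} [FibreCat C] {P : Presentation.{v, u, w, w'} C}

/-! ### The operadic functors and transformations given by evaluation -/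

/-- Evaluation in a model, for a fixed parameter. -/
noncomputable def evalFunctor (b : P.Index) (p : (P.model b).Param) (T : C) :
    P.Obj T ⥤ (P.model b).operad.obj T where
  obj X := ((value b T).obj X).obj p
  map f := ((value b T).map f).app p

/-- The expression chosen for a product need not itself be a product, but its value is the product
of the values; this gives strict compatibility. -/
noncomputable def evalOp (b : P.Index) (p : (P.model b).Param) :
    P.free.OpFunctor (P.model b).operad where
  functor T := evalFunctor b p T
  mul σ _ hF := CategoryTheory.Functor.ext (fun X => value_mkObj_mul b σ hF X.1 X.2 p)
    fun _ _ f => value_homOfMor_mul b σ hF f.1 f.2 p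
  unit := Functor.congr_obj (value_mkObj b _) p

theorem evalFunctor_act (b : P.Index) (p : (P.model b).Param) {T : C} (o : P.op T) :
    actFunctor o ⋙ evalFunctor b p T = evalFunctor b p T ⋙ (P.model b).act o :=
  CategoryTheory.Functor.ext (fun X => value_mkObj_act b o X p)
    fun _ _ f => value_homOfMor_act b o f p

/-- Since expressions evaluate to functors of the parameter, a parameter morphism acts on all
values. Compatibility with multiplication holds because `Rel` compares these functors on morphisms
too. -/
noncomputable def evalTrans (b : P.Index) {p p' : (P.model b).Param} (s : p ⟶ p') :
    evalOp b p ⟶ evalOp b p' where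
  app T :=
    { app := fun X => ((value b T).obj X).map s
      naturality := fun _ _ f => (((value b T).map f).naturality s).symm }
  mul σ _ hF x y := Functor.congr_hom (value_mkObj b (.mul σ hF x.term fun i => (y i).term)) s
  unit := (Functor.congr_hom (value_mkObj b .unit) s).trans 
    ((congrArg (eqToHom _ ≫ ·) (Category.id_comp (eqToHom _))).trans (eqToHom_trans _ _))

theorem evalTrans_act (b : P.Index) {p p' : (P.model b).Param} (s : p ⟶ p') {T : C} (o : P.op T)
    (X : P.Obj T) :
    ((evalTrans b s).app T).app ((actFunctor o).obj X) = eqToHom (value_mkObj_act b o X p) ≫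
      ((P.model b).act o).map (((evalTrans b s).app T).app X) ≫
        eqToHom (value_mkObj_act b o X p').symm :=
  Functor.congr_hom (value_mkObj b (.act o X.term)) s

theorem hom_ext_evalOp {T : C} {X Y : P.Obj T} {f g : X ⟶ Y}
    (h : ∀ b p, (evalFunctor b p T).map f = (evalFunctor b p T).map g) : f = g :=
  hom_ext fun b => NatTrans.ext (funext fun p => h b p)

theorem evalFunctor_homOfMor (b : P.Index) (p : (P.model b).Param) {T : C} {x y : P.Expr T}
    (m : P.Mor x y) : (evalFunctor b p T).map (homOfMor m) =
      eqToHom (Functor.congr_obj (value_mkObj b x) p) ≫ (m.eval b).app p ≫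
        eqToHom (Functor.congr_obj (value_mkObj b y) p).symm := by
  change ((value b T).map (homOfMor m)).app p = _
  rw [value_homOfMor, NatTrans.comp_app, NatTrans.comp_app, eqToHom_app, eqToHom_app]

/-! ### Uniqueness -/

theorem map_mkHom_conj {X Z : Type*} [Category* X] [Category* Z] {k : ℕ} {Y : Fin k → Type*}
    [∀ i, Category* (Y i)] (M : X × (∀ i, Y i) ⥤ Z) {x₁ x₂ x₃ x₄ : X} {y₁ y₂ y₃ y₄ : ∀ i, Y i}
    (h : x₁ = x₂) (f : x₂ ⟶ x₃) (h' : x₃ = x₄) (k : ∀ i, y₁ i = y₂ i) (g : ∀ i, y₂ i ⟶ y₃ i)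
    (k' : ∀ i, y₃ i = y₄ i) :
    M.map (Prod.mkHom (eqToHom h ≫ f ≫ eqToHom h')
        fun i => eqToHom (k i) ≫ g i ≫ eqToHom (k' i)) =
      eqToHom (by rw [h, funext k]) ≫ M.map (Prod.mkHom f g) ≫
        eqToHom (by rw [h', funext k']) := by
  subst h h'
  obtain rfl : y₁ = y₂ := funext k
  obtain rfl : y₃ = y₄ := funext k'
  simp

theorem map_eqToHom_conj {X Z : Type*} [Category* X] [Category* Z] (M : X ⥤ Z) {x₁ x₂ x₃ x₄ : X}
    (h : x₁ = x₂) (f : x₂ ⟶ x₃) (h' : x₃ = x₄) :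
    M.map (eqToHom h ≫ f ≫ eqToHom h') =
      eqToHom (by rw [h]) ≫ M.map f ≫ eqToHom (by rw [h']) := by
  subst h h'
  simp

/-- Three nested transports collapse into one. In the inductions below they come from replacing an
expression by its representative, from preservation of an operation, and from the inductive
hypothesis. -/
theorem conj_conj {X : Type*} [Category* X] {x₁ x₂ x₃ x₄ y₁ y₂ y₃ y₄ : X} (f : x₄ ⟶ y₄)
    (h₁ : x₁ = x₂) (h₂ : x₂ = x₃) (h₃ : x₃ = x₄) (k₁ : y₂ = y₁) (k₂ : y₃ = y₂) (k₃ : y₄ = y₃) :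
    eqToHom (h₁.trans (h₂.trans h₃)) ≫ f ≫ eqToHom (k₃.trans (k₂.trans k₁)) =
      eqToHom h₁ ≫ (eqToHom h₂ ≫ (eqToHom h₃ ≫ f ≫ eqToHom k₃) ≫ eqToHom k₂) ≫ eqToHom k₁ := by
  subst h₁ h₂ h₃ k₁ k₂ k₃
  simp

/-- This describes a formal product as an actual product in the free operad, up to transport, so
that an operadic functor can be applied to it in `map_homOfMor_eq`. -/
theorem homOfMor_mul {T S : C} (σ : T ⟶ S) {F : Fin (card S) → C} (hF : Fibres σ F)
    {x x' : P.Expr S} {y y' : ∀ i, P.Expr (F i)} (f : P.Mor x x') (g : ∀ i, P.Mor (y i) (y' i)) :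
    homOfMor (.mul σ hF f g) = eqToHom (mulFunctor_mkObj σ hF x y).symm ≫
      (mulFunctor σ hF).map (Prod.mkHom (homOfMor f) fun i => homOfMor (g i)) ≫
        eqToHom (mulFunctor_mkObj σ hF x' y') := by
  refine hom_ext_evalOp fun b p => ?_
  have h1 := Functor.congr_hom ((evalOp b p).mul σ hF)
    (Prod.mkHom (homOfMor f) fun i => homOfMor (g i))
  have h2 := (congrArg ((P.model b).operad.mul σ hF).map (congrArg₂ Prod.mkHom
    (evalFunctor_homOfMor b p f) (funext fun i => evalFunctor_homOfMor b p (g i)))).trans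
    (map_mkHom_conj _ _ _ _ _ _ _)
  rw [Functor.map_comp, Functor.map_comp, eqToHom_map, eqToHom_map, evalFunctor_homOfMor]
  exact (conj_conj _ _ _ _ _ _ _).trans (congrArg (fun t => eqToHom _ ≫ t ≫ eqToHom _)
    (h1.trans (congrArg (fun t => eqToHom _ ≫ t ≫ eqToHom _) h2))).symm

theorem homOfMor_act {T : C} (o : P.op T) {x y : P.Expr T} (f : P.Mor x y) :
    homOfMor (.act o f) = eqToHom (actFunctor_mkObj o x).symm ≫
      (actFunctor o).map (homOfMor f) ≫ eqToHom (actFunctor_mkObj o y) := by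
  refine hom_ext_evalOp fun b p => ?_
  have h1 := Functor.congr_hom (evalFunctor_act b p o) (homOfMor f)
  have h2 := (congrArg ((P.model b).act o).map (evalFunctor_homOfMor b p f)).trans
    (map_eqToHom_conj _ _ _ _)
  rw [Functor.map_comp, Functor.map_comp, eqToHom_map, eqToHom_map, evalFunctor_homOfMor]
  exact (conj_conj _ _ _ _ _ _ _).trans (congrArg (fun t => eqToHom _ ≫ t ≫ eqToHom _)
    (h1.trans (congrArg (fun t => eqToHom _ ≫ t ≫ eqToHom _) h2))).symm

variable (b : P.Index) (p : (P.model b).Param) (G : P.free.OpFunctor (P.model b).operad)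

/-- Induction on the expression: `G` preserves the unit, products and the unary operations, so its
values on generators force all others. Compatibility with unary operations is a separate hypothesis
because `OpFunctor` does not include it. -/
theorem obj_mkObj_eq
    (hact : ∀ {T : C} (o : P.op T), actFunctor o ⋙ G.functor T = G.functor T ⋙ (P.model b).act o)
    (hgen : ∀ d, (G.functor (P.ar d)).obj (mkObj (.gen d)) = ((P.model b).gen d).obj p)
    {T : C} (x : P.Expr T) :
    (G.functor T).obj (mkObj x) = ((P.model b).eval x).obj p := by
  induction x with
  | gen d => exact hgen d
  | unit => exact G.unit
  | mul σ hF x y hx hy =>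
    refine (congrArg (G.functor _).obj (mulFunctor_mkObj σ hF x y).symm).trans
      ((G.mul_obj σ hF _ _).trans ?_)
    exact congrArg ((P.model b).operad.mul σ hF).obj (Prod.ext hx (funext hy))
  | act o x hx =>
    refine (congrArg (G.functor _).obj (actFunctor_mkObj o x).symm).trans
      ((Functor.congr_obj (hact o) _).trans ?_)
    exact congrArg ((P.model b).act o).obj hx

/-- Induction on the formal composite. Only the generating morphisms need a hypothesis;
identifications are equality morphisms, and the other constructors are preserved by `G`. -/
theorem map_homOfMor_eq
    (hact : ∀ {T : C} (o : P.op T), actFunctor o ⋙ G.functor T = G.functor T ⋙ (P.model b).act o)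
    (hgen : ∀ d, (G.functor (P.ar d)).obj (mkObj (.gen d)) = ((P.model b).gen d).obj p)
    (hcell : ∀ {T : C} (j : P.Cell T),
      (G.functor T).map (homOfMor (.cell j)) = eqToHom (obj_mkObj_eq b p G hact hgen (P.src j)) ≫
        (P.interp b j).app p ≫ eqToHom (obj_mkObj_eq b p G hact hgen (P.tgt j)).symm)
    {T : C} {x y : P.Expr T} (m : P.Mor x y) :
    (G.functor T).map (homOfMor m) = eqToHom (obj_mkObj_eq b p G hact hgen x) ≫
      (m.eval b).app p ≫ eqToHom (obj_mkObj_eq b p G hact hgen y).symm := by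
  induction m with
  | id x =>
    rw [homOfMor_id]
    refine ((G.functor _).map_id _).trans ?_
    simp [Mor.eval]
  | comp f g hf hg =>
    rw [homOfMor_comp]
    refine ((G.functor _).map_comp _ _).trans ?_
    rw [hf, hg]
    simp [Mor.eval]
  | mul σ hF f g hf hg =>
    have h1 := G.mul_map σ hF (homOfMor f) fun i => homOfMor (g i)
    have h2 := (congrArg ((P.model b).operad.mul σ hF).map (congrArg₂ Prod.mkHom hf
      (funext hg))).trans (map_mkHom_conj _ _ _ _ _ _ _)
    refine (congrArg (G.functor _).map (homOfMor_mul σ hF f g)).trans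
      ((map_eqToHom_conj (G.functor _) _ _ _).trans ?_)
    exact ((conj_conj _ _ _ _ _ _ _).trans (congrArg (fun t => eqToHom _ ≫ t ≫ eqToHom _)
      (h1.trans (congrArg (fun t => eqToHom _ ≫ t ≫ eqToHom _) h2))).symm).symm
  | act o f hf =>
    have h1 := Functor.congr_hom (hact o) (homOfMor f)
    have h2 := (congrArg ((P.model b).act o).map hf).trans (map_eqToHom_conj _ _ _ _)
    refine (congrArg (G.functor _).map (homOfMor_act o f)).trans
      ((map_eqToHom_conj (G.functor _) _ _ _).trans ?_)
    exact ((conj_conj _ _ _ _ _ _ _).trans (congrArg (fun t => eqToHom _ ≫ t ≫ eqToHom _)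
      (h1.trans (congrArg (fun t => eqToHom _ ≫ t ≫ eqToHom _) h2))).symm).symm
  | cell j => exact hcell j
  | ofRel h =>
    rw [homOfMor_ofRel]
    refine (eqToHom_map (G.functor _) _).trans ?_
    simp [Mor.eval, eqToHom_app]

/-- An operadic functor on the free operad is determined by its values on generators. -/
theorem eq_evalOp
    (hact : ∀ {T : C} (o : P.op T), actFunctor o ⋙ G.functor T = G.functor T ⋙ (P.model b).act o)
    (hgen : ∀ d, (G.functor (P.ar d)).obj (mkObj (.gen d)) = ((P.model b).gen d).obj p)
    (hcell : ∀ {T : C} (j : P.Cell T),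
      HEq ((G.functor T).map (homOfMor (.cell j))) ((P.interp b j).app p)) :
    G = evalOp b p := by
  -- The heterogeneous equality of the hypothesis is made into conjugation by transports, which can
  -- be stated only after the values on objects are known to agree.
  have hcell' : ∀ {T : C} (j : P.Cell T),
      (G.functor T).map (homOfMor (.cell j)) = eqToHom (obj_mkObj_eq b p G hact hgen (P.src j)) ≫
        (P.interp b j).app p ≫ eqToHom (obj_mkObj_eq b p G hact hgen (P.tgt j)).symm := fun j =>
    (conj_eqToHom_iff_heq _ _ (obj_mkObj_eq b p G hact hgen (P.src j))
      (obj_mkObj_eq b p G hact hgen (P.tgt j))).2 (hcell j)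
  have hobj : ∀ {T : C} (X : P.Obj T), (G.functor T).obj X = ((value b T).obj X).obj p :=
    fun X => (congrArg (G.functor _).obj (mkObj_term X).symm).trans
      (obj_mkObj_eq b p G hact hgen X.term)
  refine OpFunctor.ext (funext fun T => CategoryTheory.Functor.ext (fun X => hobj X) ?_)
  intro X Y f
  obtain ⟨m, rfl⟩ := exists_mkHom f
  refine (congrArg (G.functor T).map (mkHom_eq m)).trans
    ((map_eqToHom_conj (G.functor T) _ _ _).trans ?_)
  rw [map_homOfMor_eq b p G hact hgen hcell' m]
  simp only [Category.assoc, eqToHom_trans, eqToHom_trans_assoc]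
  rfl

/-- An operadic transformation on the free operad is determined by its values on generators. -/
theorem opTrans_ext {A : CatOperad.{v, u} C} {Φ Ψ : P.free.OpFunctor A} (α β : OpTrans Φ Ψ)
    (hact : ∀ {T : C} (o : P.op T) (X : P.Obj T), (α.app T).app X = (β.app T).app X →
      (α.app T).app ((actFunctor o).obj X) = (β.app T).app ((actFunctor o).obj X))
    (hgen : ∀ d, (α.app (P.ar d)).app (mkObj (.gen d)) = (β.app (P.ar d)).app (mkObj (.gen d))) :
    α = β := by
  -- The axioms of an operadic transformation determine its components at the unit and at products
  -- from smaller components, which permits induction on expressions.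
  have key : ∀ {T : C} (x : P.Expr T),
      (α.app T).app (mkObj x : P.Obj T) = (β.app T).app (mkObj x : P.Obj T) := by
    intro T x
    induction x with
    | gen d => exact hgen d
    | unit => exact α.unit.trans β.unit.symm
    | mul σ hF x y hx hy =>
      rw [← mulFunctor_mkObj]
      refine (α.mul σ hF _ _).trans (Eq.trans ?_ (β.mul σ hF _ _).symm)
      rw [hx, show (fun i => (α.app _).app (mkObj (y i) : P.Obj _)) = _ from funext hy]
    | act o x hx =>
      rw [← actFunctor_mkObj]
      exact hact o _ hx
  have key' : ∀ {T : C} (X : P.Obj T), (α.app T).app X = (β.app T).app X := fun X => by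
    rw [← mkObj_term X]
    exact key _
  exact OpTrans.ext (funext fun T => NatTrans.ext (funext fun X => key' X))

end Presentation
namespace InternalOperad

/-! ### Lifting internal operads along jointly faithful operadic functors -/

section Reflect

variable {D : Type} [FibreCat D] {K A : CatOperad.{v, u} D} (Φ : K.OpFunctor A)
  (a : InternalOperad A) (obj : ∀ T, K.obj T)
  (mul : ∀ {T S : D} (σ : T ⟶ S) {F : Fin (card S) → D} (hF : Fibres σ F),
    (K.mul σ hF).obj (obj S, fun i => obj (F i)) ⟶ obj T)
  (unit : K.unit ⟶ obj pt)

theorem eq_eqToHom_comp_of_heq {X : Type*} [Category* X] {x y z : X} {f : x ⟶ z} {g : y ⟶ z}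
    (h : x = y) (hfg : HEq f g) : f = eqToHom h ≫ g := by
  subst h
  simpa using hfg

/-- The images of the two sides in `A` are the two sides of the associativity law of `a`, up to
transport. Comparing operations by `HEq` allows objects of `a` that are only propositionally equal
to the images of `obj`. -/
theorem map_assoc_of_image
    (hobj : ∀ T, a.obj T = (Φ.functor T).obj (obj T))
    (hmul : ∀ {T S : D} (σ : T ⟶ S) {F : Fin (card S) → D} (hF : Fibres σ F),
      HEq (a.mul σ hF) ((Φ.functor T).map (mul σ hF)))
    {T S R : D} (σ : T ⟶ S) (ω : S ⟶ R) {X Y : Fin (card R) → D}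
    {Z : Fin (card S) → D} (hX : Fibres (σ ≫ ω) X) (hY : Fibres ω Y) (hZ : Fibres σ Z)
    (τ : ∀ i, X i ⟶ Y i) (hτ : ∀ i, τ i ≫ hY.incl i = hX.incl i ≫ σ)
    (hW : ∀ i, Fibres (τ i) fun j => Z (tip (hY.incl i) j)) :
    (Φ.functor T).map
        ((K.mul σ hZ).map (Prod.mkHom (mul ω hY) fun j => 𝟙 (obj (Z j))) ≫ mul σ hZ) =
      (Φ.functor T).map
        (eqToHom (K.assoc_obj σ ω hX hY hZ τ hτ hW (obj R) (fun i => obj (Y i)) fun j => obj (Z j)) ≫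
          (K.mul (σ ≫ ω) hX).map (Prod.mkHom (𝟙 (obj R)) fun i => mul (τ i) (hW i)) ≫
            mul (σ ≫ ω) hX) := by
  revert hobj hmul
  -- Taking `a` apart makes its family of objects a variable, which can then be replaced by the
  -- images of `obj`.
  obtain ⟨ao, am, au, h, -, -⟩ := a
  intro hobj hmul
  obtain rfl : ao = fun T => (Φ.functor T).obj (obj T) := funext hobj
  have am' : ∀ {T S : D} (σ : T ⟶ S) {F : Fin (card S) → D} (hF : Fibres σ F),
      am σ hF = eqToHom (Φ.mul_obj σ hF _ _).symm ≫ (Φ.functor T).map (mul σ hF) := fun σ F hF =>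
    eq_eqToHom_comp_of_heq _ (hmul σ hF)
  have h := h σ ω hX hY hZ τ hτ hW
  simp only [am'] at h
  have h1 := mul_map_functor Φ σ hZ (Φ.mul_obj ω hY _ _).symm (mul ω hY) (fun _ => rfl)
    (fun j => 𝟙 (obj (Z j)))
  have h2 := mul_map_functor Φ (σ ≫ ω) hX rfl (𝟙 (obj _))
    (fun i => (Φ.mul_obj (τ i) (hW i) _ _).symm) (fun i => mul (τ i) (hW i))
  simp only [eqToHom_refl, Category.id_comp, CategoryTheory.Functor.map_id] at h1 h2
  rw [h1, h2] at h
  simp only [Category.assoc, eqToHom_trans_assoc, eqToHom_refl, Category.id_comp] at h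
  rw [← Functor.map_comp, ← Functor.map_comp] at h
  rw [Functor.map_comp (Φ.functor T) (eqToHom _), eqToHom_map]
  refine (cancel_epi (eqToHom _)).1 (h.trans ?_)
  rw [eqToHom_trans_assoc]

theorem map_mul_id_of_image
    (hobj : ∀ T, a.obj T = (Φ.functor T).obj (obj T))
    (hmul : ∀ {T S : D} (σ : T ⟶ S) {F : Fin (card S) → D} (hF : Fibres σ F),
      HEq (a.mul σ hF) ((Φ.functor T).map (mul σ hF)))
    (hunit : HEq a.unit ((Φ.functor pt).map unit))
    {T : D} (hF : Fibres (𝟙 T) fun _ => pt) :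
    (Φ.functor T).map
        ((K.mul (𝟙 T) hF).map (Prod.mkHom (𝟙 (obj T)) fun _ => unit) ≫ mul (𝟙 T) hF) =
      (Φ.functor T).map (eqToHom (K.mul_id_obj hF (obj T))) := by
  revert hobj hmul hunit
  obtain ⟨ao, am, au, -, h, -⟩ := a
  intro hobj hmul hunit
  obtain rfl : ao = fun T => (Φ.functor T).obj (obj T) := funext hobj
  have am' : ∀ {T S : D} (σ : T ⟶ S) {F : Fin (card S) → D} (hF : Fibres σ F),
      am σ hF = eqToHom (Φ.mul_obj σ hF _ _).symm ≫ (Φ.functor T).map (mul σ hF) := fun σ F hF =>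
    eq_eqToHom_comp_of_heq _ (hmul σ hF)
  have au' : au = eqToHom Φ.unit.symm ≫ (Φ.functor pt).map unit :=
    eq_eqToHom_comp_of_heq _ hunit
  have h := h hF
  simp only [am', au'] at h
  have h1 := mul_map_functor Φ (𝟙 _) hF rfl (𝟙 (obj _)) (fun _ => Φ.unit.symm) (fun _ => unit)
  simp only [eqToHom_refl, Category.id_comp, CategoryTheory.Functor.map_id] at h1
  rw [h1] at h
  simp only [Category.assoc, eqToHom_trans_assoc, eqToHom_refl, Category.id_comp] at h
  rw [← Functor.map_comp] at h
  rw [eqToHom_map]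
  refine (cancel_epi (eqToHom _)).1 (h.trans ?_)
  rw [eqToHom_trans]

theorem map_id_mul_of_image
    (hobj : ∀ T, a.obj T = (Φ.functor T).obj (obj T))
    (hmul : ∀ {T S : D} (σ : T ⟶ S) {F : Fin (card S) → D} (hF : Fibres σ F),
      HEq (a.mul σ hF) ((Φ.functor T).map (mul σ hF)))
    (hunit : HEq a.unit ((Φ.functor pt).map unit))
    {T : D} (σ : T ⟶ pt) (hF : Fibres σ fun _ => T) :
    (Φ.functor T).map
        ((K.mul σ hF).map (Prod.mkHom unit fun _ => 𝟙 (obj T)) ≫ mul σ hF) =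
      (Φ.functor T).map (eqToHom (K.id_mul_obj σ hF (obj T))) := by
  revert hobj hmul hunit
  obtain ⟨ao, am, au, -, -, h⟩ := a
  intro hobj hmul hunit
  obtain rfl : ao = fun T => (Φ.functor T).obj (obj T) := funext hobj
  have am' : ∀ {T S : D} (σ : T ⟶ S) {F : Fin (card S) → D} (hF : Fibres σ F),
      am σ hF = eqToHom (Φ.mul_obj σ hF _ _).symm ≫ (Φ.functor T).map (mul σ hF) := fun σ F hF =>
    eq_eqToHom_comp_of_heq _ (hmul σ hF)
  have au' : au = eqToHom Φ.unit.symm ≫ (Φ.functor pt).map unit :=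
    eq_eqToHom_comp_of_heq _ hunit
  have h := h σ hF
  simp only [am', au'] at h
  have h1 := mul_map_functor Φ σ hF Φ.unit.symm unit (fun _ => rfl) (fun _ => 𝟙 (obj _))
  simp only [eqToHom_refl, Category.id_comp, CategoryTheory.Functor.map_id] at h1
  rw [h1] at h
  simp only [Category.assoc, eqToHom_trans_assoc, eqToHom_refl, Category.id_comp] at h
  rw [← Functor.map_comp] at h
  rw [eqToHom_map]
  refine (cancel_epi (eqToHom _)).1 (h.trans ?_)
  rw [eqToHom_trans]

end Reflect

/-- Operations whose images under jointly faithful operadic functors are the operations of internal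
operads form an internal operad. -/
def ofJointlyFaithful {D : Type} [FibreCat D] {K : CatOperad.{v, u} D} {I : Type*}
    {A : I → CatOperad.{v, u} D} (Φ : ∀ i, K.OpFunctor (A i)) (a : ∀ i, InternalOperad (A i))
    (faithful : ∀ {T : D} {x y : K.obj T} (f g : x ⟶ y),
      (∀ i, ((Φ i).functor T).map f = ((Φ i).functor T).map g) → f = g)
    (obj : ∀ T, K.obj T)
    (mul : ∀ {T S : D} (σ : T ⟶ S) {F : Fin (card S) → D} (hF : Fibres σ F),
      (K.mul σ hF).obj (obj S, fun i => obj (F i)) ⟶ obj T)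
    (unit : K.unit ⟶ obj pt)
    (hobj : ∀ i T, (a i).obj T = ((Φ i).functor T).obj (obj T))
    (hmul : ∀ i {T S : D} (σ : T ⟶ S) {F : Fin (card S) → D} (hF : Fibres σ F),
      HEq ((a i).mul σ hF) (((Φ i).functor T).map (mul σ hF)))
    (hunit : ∀ i, HEq (a i).unit (((Φ i).functor pt).map unit)) : InternalOperad K where
  obj := obj
  mul := mul
  unit := unit
  assoc σ ω _ _ _ hX hY hZ τ hτ hW := faithful _ _ fun i =>
    map_assoc_of_image (Φ i) (a i) obj mul (hobj i) (hmul i) σ ω hX hY hZ τ hτ hW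
  mul_id hF := faithful _ _ fun i =>
    map_mul_id_of_image (Φ i) (a i) obj mul unit (hobj i) (hmul i) (hunit i) hF
  id_mul σ hF := faithful _ _ fun i =>
    map_id_mul_of_image (Φ i) (a i) obj mul unit (hobj i) (hmul i) (hunit i) σ hF

end InternalOperad

/-! ### Universal elements of 2-functors -/

namespace Represents

open Bicategory

variable {B : Type*} [Bicategory B] [Bicategory.Strict B]
  (G : StrictPseudofunctor B Cat.{v, u}) (h : B) (x : G.obj h)

/-- The functor that applies `G` and evaluates at a given element. -/
@[simps]
def evalAt (A : B) : (h ⟶ A) ⥤ G.obj A where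
  obj Φ := (G.map Φ).toFunctor.obj x
  map α := (G.map₂ α).toNatTrans.app x
  map_id Φ := by rw [G.map₂_id]; rfl
  map_comp α β := by rw [G.map₂_comp]; rfl

theorem evalAt_comp_obj {A D : B} (f : A ⟶ D) (Φ : h ⟶ A) :
    (evalAt G h x D).obj (Φ ≫ f) = (G.map f).toFunctor.obj ((evalAt G h x A).obj Φ) :=
  congrArg (fun t : G.obj h ⟶ G.obj D => t.toFunctor.obj x) (G.map_comp Φ f)

/-- Strictness makes the comparison cells of `G` equality morphisms, so evaluation at a fixed
element, as in the Yoneda lemma, is strictly natural. -/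
theorem evalAt_naturality {A D : B} (f : A ⟶ D) :
    postcomp h f ⋙ evalAt G h x D = evalAt G h x A ⋙ (G.map f).toFunctor :=
  CategoryTheory.Functor.ext (fun Φ => evalAt_comp_obj G h x f Φ) fun Φ Ψ α => by
    change (G.map₂ (α ▷ f)).toNatTrans.app x = _
    rw [G.map₂_whisker_right, G.mapComp_eq_eqToIso, G.mapComp_eq_eqToIso]
    simp only [eqToIso.hom, eqToIso.inv, Cat.Hom₂.comp_app, Cat.eqToHom_app]
    rfl

theorem evalAt_naturality₂ {A D : B} {f g : A ⟶ D} (α : f ⟶ g) (Φ : h ⟶ A) :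
    (evalAt G h x D).map (Φ ◁ α) =
      eqToHom (evalAt_comp_obj G h x f Φ) ≫ (G.map₂ α).toNatTrans.app ((evalAt G h x A).obj Φ) ≫
        eqToHom (evalAt_comp_obj G h x g Φ).symm := by
  change (G.map₂ (Φ ◁ α)).toNatTrans.app x = _
  rw [G.map₂_whisker_left, G.mapComp_eq_eqToIso, G.mapComp_eq_eqToIso]
  simp only [eqToIso.hom, eqToIso.inv, Cat.Hom₂.comp_app, Cat.eqToHom_app]
  rfl

/-- A 2-functor is represented by `h` if it has a universal element at `h`. -/
def ofUniversal (inv : ∀ A, G.obj A ⥤ (h ⟶ A))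
    (hom_inv : ∀ A, evalAt G h x A ⋙ inv A = 𝟭 (h ⟶ A))
    (inv_hom : ∀ A, inv A ⋙ evalAt G h x A = 𝟭 (G.obj A)) : Represents G h where
  hom := evalAt G h x
  inv := inv
  hom_inv := hom_inv
  inv_hom := inv_hom
  naturality := evalAt_naturality G h x
  naturality₂ := evalAt_naturality₂ G h x

end Represents

/-- The structure morphisms of an internal operad. -/
inductive OpCell (D : Type) [FibreCat D] : D → Type
  | mul {T S : D} (σ : T ⟶ S) {F : Fin (card S) → D} (hF : Fibres σ F) : OpCell D T
  | unit : OpCell D pt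

namespace InternalOperad

variable {D : Type} [FibreCat D]

/-- Evaluation of internal operads at an object. -/
@[simps]
def component (A : CatOperad.{v, u} D) (T : D) : InternalOperad A ⥤ A.obj T where
  obj a := a.obj T
  map f := f.app T

@[simps]
def mulTrans (A : CatOperad.{v, u} D) {T S : D} (σ : T ⟶ S) {F : Fin (card S) → D}
    (hF : Fibres σ F) :
    tuple (component A S) (fun i => component A (F i)) ⋙ A.mul σ hF ⟶ component A T where
  app a := a.mul σ hF
  naturality _ _ f := (f.mul σ hF).symm

@[simps]
def unitTrans (A : CatOperad.{v, u} D) : (Functor.const _).obj A.unit ⟶ component A pt where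
  app a := a.unit
  naturality _ _ f := (Category.id_comp _).trans f.unit.symm

end InternalOperad

namespace CatOperad

theorem conj_app_app {C : Type} [FibreCat C] {A B : CatOperad.{v, u} C}
    {Φ Φ' Ψ' Ψ : A.OpFunctor B} (h : Φ = Φ') (α : Φ' ⟶ Ψ') (h' : Ψ' = Ψ) {T : C} (x : A.obj T)
    (g : (Φ.functor T).obj x ⟶ (Ψ.functor T).obj x) (hg : HEq g ((α.app T).app x)) :
    g = (OpTrans.app (eqToHom h ≫ α ≫ eqToHom h') T).app x := by
  subst h h'
  rw [eqToHom_refl, Category.id_comp, eqToHom_refl, Category.comp_id]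
  exact eq_of_heq hg

end CatOperad

namespace Presentation

variable {C : Type} [FibreCat C] {P : Presentation.{v, u, w, w'} C}

theorem evalTrans_id (b : P.Index) (p : (P.model b).Param) : evalTrans b (𝟙 p) = 𝟙 (evalOp b p) :=
  hom₂_ext fun T => NatTrans.ext (funext fun X => ((value b T).obj X).map_id p)

theorem evalTrans_comp (b : P.Index) {p q r : (P.model b).Param} (s : p ⟶ q) (t : q ⟶ r) :
    evalTrans b (s ≫ t) = evalTrans b s ≫ evalTrans b t :=
  hom₂_ext fun T => NatTrans.ext (funext fun X => ((value b T).obj X).map_comp s t)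

theorem evalFunctor_mkObj (b : P.Index) (p : (P.model b).Param) {T : C} (x : P.Expr T) :
    (evalFunctor b p T).obj (mkObj x) = ((P.model b).eval x).obj p :=
  Functor.congr_obj (value_mkObj b x) p

theorem evalFunctor_homOfMor_heq (b : P.Index) (p : (P.model b).Param) {T : C} {x y : P.Expr T}
    (m : P.Mor x y) : HEq ((evalFunctor b p T).map (homOfMor m)) ((m.eval b).app p) :=
  (conj_eqToHom_iff_heq _ _ (evalFunctor_mkObj b p x) (evalFunctor_mkObj b p y)).1
    (evalFunctor_homOfMor b p m)

theorem evalTrans_mkObj_heq (b : P.Index) {p q : (P.model b).Param} (s : p ⟶ q) {T : C}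
    (x : P.Expr T) :
    HEq (((evalTrans b s).app T).app (mkObj x)) (((P.model b).eval x).map s) :=
  (conj_eqToHom_iff_heq _ _ (evalFunctor_mkObj b p x) (evalFunctor_mkObj b q x)).1
    (Functor.congr_hom (value_mkObj b x) s)

theorem map_eqToHom_comp_heq {X Y : Type*} [Category* X] [Category* Y] (G : X ⥤ Y) {x y z : X}
    (h : x = y) (f : y ⟶ z) : HEq (G.map (eqToHom h ≫ f)) (G.map f) := by
  subst h
  simp

end Presentation

/-! ### The universal categorical operad with an internal operad -/

namespace CatOperad

open Presentation

variable (C : Type) [FibreCat C]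

/-- The presentation of the universal categorical operad with an internal operad. -/
def presentation : Presentation.{v, u, max v u, max (v + 1) (u + 1)} C where
  op _ := PEmpty
  Gen := C
  ar T := T
  Index := CatOperad.{v, u} C
  model A :=
    { operad := A
      act := fun o => o.elim
      Param := InternalOperad A
      gen := InternalOperad.component A }
  Cell := OpCell C
  src j := match j with
    | .mul σ hF => .mul σ hF (.gen _) fun _ => .gen _
    | .unit => .unit
  tgt _ := .gen _
  interp A _ j := match j with
    | .mul σ hF => InternalOperad.mulTrans A σ hF
    | .unit => InternalOperad.unitTrans A

/-- The transport is needed because the product of the classes of generators is only propositionally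
equal to the class of the product expression, which is the source of the generating morphism. -/
noncomputable def universalMul {T S : C} (σ : T ⟶ S) {F : Fin (card S) → C} (hF : Fibres σ F) :
    (mulFunctor σ hF).obj (mkObj (P := presentation.{v, u} C) (.gen S), fun i => mkObj (.gen (F i))) ⟶
      mkObj (P := presentation.{v, u} C) (.gen T) :=
  eqToHom (mulFunctor_mkObj σ hF _ _) ≫
    homOfMor (Mor.cell (P := presentation.{v, u} C) (T := T) (OpCell.mul σ hF))

noncomputable def universalUnit :
    mkObj .unit ⟶ mkObj (P := presentation.{v, u} C) (.gen (pt : C)) :=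
  homOfMor (Mor.cell (P := presentation.{v, u} C) (T := pt) OpCell.unit)

variable {C} in
theorem evalFunctor_universalMul (A : CatOperad.{v, u} C) (a : InternalOperad A) {T S : C}
    (σ : T ⟶ S) {F : Fin (card S) → C} (hF : Fibres σ F) :
    HEq ((evalFunctor (P := presentation C) A a T).map (universalMul C σ hF)) (a.mul σ hF) :=
  (map_eqToHom_comp_heq (evalFunctor (P := presentation C) A a T)
    (mulFunctor_mkObj (P := presentation C) σ hF _ _) _).trans
    (evalFunctor_homOfMor_heq (P := presentation C) A a (.cell (T := T) (OpCell.mul σ hF)))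

variable {C} in
theorem evalFunctor_universalUnit (A : CatOperad.{v, u} C) (a : InternalOperad A) :
    HEq ((evalFunctor (P := presentation C) A a pt).map (universalUnit C)) a.unit :=
  evalFunctor_homOfMor_heq (P := presentation C) A a
    (Mor.cell (P := presentation.{v, u} C) (T := pt) OpCell.unit)

/-- The universal internal operad. -/
noncomputable def universal : InternalOperad (presentation.{v, u} C).free :=
  InternalOperad.ofJointlyFaithful (I := Σ A : CatOperad.{v, u} C, InternalOperad A)
    (fun i => evalOp (P := presentation C) i.1 i.2) (fun i => i.2)
    (fun _ _ h => hom_ext_evalOp fun b p => h ⟨b, p⟩)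
    (fun T => mkObj (P := presentation C) (.gen T))
    (universalMul C) (universalUnit C)
    (fun i T => (evalFunctor_mkObj (P := presentation C) i.1 i.2 (.gen T)).symm)
    (fun i _ _ σ _ hF => (evalFunctor_universalMul i.1 i.2 σ hF).symm)
    (fun i => (evalFunctor_universalUnit i.1 i.2).symm)

variable {C} in
noncomputable def ofInternal (A : CatOperad.{v, u} C) :
    InternalOperad A ⥤ ((presentation.{v, u} C).free ⟶ A) where
  obj a := evalOp (P := presentation C) A a
  map f := evalTrans (P := presentation C) A f
  map_id a := evalTrans_id (P := presentation C) A a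
  map_comp f g := evalTrans_comp (P := presentation C) A f g

-- Uniqueness: the image of the universal internal operad records exactly the values of `Φ` on
-- generators and generating morphisms, as required by `eq_evalOp`.
variable {C} in
theorem ofInternal_map_obj {A : CatOperad.{v, u} C} (Φ : (presentation.{v, u} C).free ⟶ A) :
    (ofInternal A).obj ((InternalOperad.map Φ).obj (universal C)) = Φ := by
  refine (eq_evalOp (P := presentation C) A _ Φ (fun o => o.elim) (fun _ => rfl) ?_).symm
  rintro T (⟨σ, hF⟩ | _)
  · exact ((eqToHom_comp_heq _ _).trans (map_eqToHom_comp_heq (Φ.functor T) _ _)).symm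
  · exact (eqToHom_comp_heq ((Φ.functor pt).map (universalUnit C)) _).symm

-- Existence: evaluation at `a` sends each generator and each generating morphism to the
-- corresponding constituent of `a`.
variable {C} in
theorem map_ofInternal_obj {A : CatOperad.{v, u} C} (a : InternalOperad A) :
    (InternalOperad.map ((ofInternal A).obj a)).obj (universal C) = a := by
  refine InternalOperad.ext' (funext fun T => evalFunctor_mkObj (P := presentation C) A a (.gen T))
    (fun {T S} σ F hF => ?_) ?_
  · exact (eqToHom_comp_heq _ _).trans (evalFunctor_universalMul A a σ hF)
  · exact (eqToHom_comp_heq _ _).trans (evalFunctor_universalUnit A a)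

/-- The universal categorical operad represents the 2-functor of internal operads. -/
noncomputable def represents : Represents (IntOp C) (presentation.{v, u} C).free :=
  Represents.ofUniversal (IntOp C) _ (universal C) (fun A => ofInternal A)
    (fun A => CategoryTheory.Functor.ext (fun Φ => ofInternal_map_obj Φ) fun Φ Ψ α => by
      refine opTrans_ext (P := presentation C) _ _ (fun o => o.elim) fun T => ?_
      exact conj_app_app (ofInternal_map_obj Φ) α (ofInternal_map_obj Ψ).symm _ _
        (evalTrans_mkObj_heq (P := presentation C) A _ (.gen T)))
    (fun A => InternalOperad.functor_ext (fun a => map_ofInternal_obj a)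
      fun f T => evalTrans_mkObj_heq (P := presentation C) A f (.gen T))

end CatOperad

/-- Generators and generating morphisms for left symmetric categorical operads. The models are all
left symmetric categorical operads, with parameters `Param`. -/
structure SymPresentation where
  Gen : Type
  ar : Gen → OmegaMono
  Param : SymOperad.{v, u} → Type w
  [category : ∀ A, Category.{v} (Param A)]
  gen : ∀ A d, Param A ⥤ A.obj (ar d)
  Cell : OmegaMono → Type
  src : ∀ {n}, Cell n → Term (fun n : OmegaMono => Equiv.Perm (Fin n.size)) ar n
  tgt : ∀ {n}, Cell n → Term (fun n : OmegaMono => Equiv.Perm (Fin n.size)) ar n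
  interp : ∀ (A : SymOperad.{v, u}) {n} (j : Cell n),
    (Model.mk (op := fun n : OmegaMono => Equiv.Perm (Fin n.size)) A.toCatOperad
      (fun {n} => A.act n) (Param A) (gen A)).eval (src j) ⟶
    (Model.mk (op := fun n : OmegaMono => Equiv.Perm (Fin n.size)) A.toCatOperad
      (fun {n} => A.act n) (Param A) (gen A)).eval (tgt j)

attribute [instance] SymPresentation.category

/-! ### Free left symmetric categorical operads -/

namespace SymPresentation

open Presentation SymOperad

variable (P : SymPresentation.{v, u, w})

def toPresentation : Presentation.{v, u, w, max (v + 1) (u + 1)} OmegaMono where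
  op n := Equiv.Perm (Fin n.size)
  Gen := P.Gen
  ar := P.ar
  Index := SymOperad.{v, u}
  model A := Model.mk A.toCatOperad (fun {n} => A.act n) (P.Param A) (P.gen A)
  Cell := P.Cell
  src := P.src
  tgt := P.tgt
  interp := P.interp

abbrev Obj (n : OmegaMono) : Type u := P.toPresentation.Obj n

variable {P}

/-- The action of permutations on the objects of the free operad. -/
noncomputable def permFunctor (n : OmegaMono) (π : Equiv.Perm (Fin n.size)) : P.Obj n ⥤ P.Obj n :=
  actFunctor (P := P.toPresentation) (T := n) π

theorem lift_permFunctor (A : SymOperad.{v, u}) (n : OmegaMono) (π : Equiv.Perm (Fin n.size))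
    {E : Type*} [Category* E] (x : E ⥤ P.Obj n) :
    lift (P := P.toPresentation) A (x ⋙ permFunctor n π) =
      lift (P := P.toPresentation) A x ⋙ A.act n π :=
  lift_act (P := P.toPresentation) A (T := n) π x

theorem permFunctor_one (n : OmegaMono) : permFunctor (P := P) n 1 = 𝟭 _ := by
  refine functor_ext fun A => ?_
  refine (lift_permFunctor A n 1 (𝟭 _)).trans ?_
  exact congrArg (lift (P := P.toPresentation) A (𝟭 _) ⋙ ·) (SymOperad.act_one A n)

theorem permFunctor_mul (n : OmegaMono) (π ρ : Equiv.Perm (Fin n.size)) :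
    permFunctor (P := P) n (π * ρ) = permFunctor n ρ ⋙ permFunctor n π := by
  refine functor_ext fun A => ?_
  refine (lift_permFunctor A n (π * ρ) (𝟭 _)).trans
    (Eq.trans ?_ (lift_permFunctor A n π (permFunctor n ρ)).symm)
  refine Eq.trans ?_ (congrArg (· ⋙ _) (lift_permFunctor A n ρ (𝟭 _)).symm)
  exact congrArg (lift (P := P.toPresentation) A (𝟭 _) ⋙ ·) (SymOperad.act_mul A n π ρ)

/-- Lifting to a model replaces the formal permutations by actual actions, so equivariance is
inherited from each symmetric operad. -/
theorem mulFunctor_permFunctor_outer {n k : OmegaMono} (σ σ' : n ⟶ k) (ρ : Equiv.Perm (Fin k.size))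
    (π : Equiv.Perm (Fin n.size)) (h : ∀ x, ρ (tip σ' x) = tip σ (π x))
    (h' : ∀ x y, tip σ' x = tip σ' y → x ≤ y → π x ≤ π y)
    {d : Fin k.size → OmegaMono} (hd : Fibres σ d) (hd' : Fibres σ' fun i => d (ρ i))
    {E : Type*} [Category* E] (a : E ⥤ P.Obj k) (b : ∀ i, E ⥤ P.Obj (d i)) :
    tuple (a ⋙ permFunctor k ρ) b ⋙ mulFunctor σ hd =
      tuple a (fun i => b (ρ i)) ⋙ mulFunctor σ' hd' ⋙
        permFunctor n π := by
  refine functor_ext fun A => ?_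
  refine (lift_mul (P := P.toPresentation) A σ hd _ b).trans
    (Eq.trans ?_ (lift_permFunctor A n π (tuple a _ ⋙ mulFunctor σ' hd')).symm)
  refine (congrArg (fun t => tuple t _ ⋙ A.mul σ hd) (lift_permFunctor A k ρ a)).trans ?_
  refine Eq.trans ?_ (congrArg (· ⋙ A.act n π)
    (lift_mul (P := P.toPresentation) A σ' hd' a _)).symm
  exact SymOperad.mul_act_of_large A σ σ' ρ π h h' hd hd' _ _

theorem mulFunctor_permFunctor_inner {n k : OmegaMono} (σ : n ⟶ k) (π : Equiv.Perm (Fin n.size))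
    {d : Fin k.size → OmegaMono} (hd : Fibres σ d) (θ : ∀ i, Equiv.Perm (Fin (d i).size))
    (h : ∀ i x, tip (hd.incl i) (θ i x) = π (tip (hd.incl i) x))
    {E : Type*} [Category* E] (a : E ⥤ P.Obj k) (b : ∀ i, E ⥤ P.Obj (d i)) :
    tuple a (fun i => b i ⋙ permFunctor (d i) (θ i)) ⋙
        mulFunctor σ hd =
      tuple a b ⋙ mulFunctor σ hd ⋙ permFunctor n π := by
  refine functor_ext fun A => ?_
  refine (lift_mul (P := P.toPresentation) A σ hd a _).trans
    (Eq.trans ?_ (lift_permFunctor A n π (tuple a b ⋙ mulFunctor σ hd)).symm)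
  refine (congrArg (fun t => tuple (lift (P := P.toPresentation) A a) t ⋙ A.mul σ hd)
    (funext fun i => lift_permFunctor A (d i) (θ i) (b i))).trans ?_
  refine Eq.trans ?_ (congrArg (· ⋙ A.act n π)
    (lift_mul (P := P.toPresentation) A σ hd a b)).symm
  exact SymOperad.mul_act_fibre_of_large A σ π hd θ h _ _

variable (P)

/-- The free left symmetric categorical operad. -/
noncomputable def free : SymOperad.{v, u} where
  toCatOperad := P.toPresentation.free
  act n π := permFunctor n π
  act_one := permFunctor_one
  act_mul := permFunctor_mul
  mul_act σ σ' ρ π h h' _ hd hd' _ a b := mulFunctor_permFunctor_outer σ σ' ρ π h h' hd hd' a b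
  mul_act_fibre σ π _ hd θ h _ a b := mulFunctor_permFunctor_inner σ π hd θ h a b

/-- Evaluation as a functor from parameters to symmetric operadic functors. -/
noncomputable def ofParam (A : SymOperad.{v, u}) : P.Param A ⥤ (P.free ⟶ A) where
  obj p :=
    { toOpFunctor := evalOp (P := P.toPresentation) A p
      act := fun n π => evalFunctor_act (P := P.toPresentation) A p (T := n) π }
  map s :=
    { toOpTrans := evalTrans (P := P.toPresentation) A s
      act := fun n π X => evalTrans_act (P := P.toPresentation) A s (T := n) π X }
  map_id p := SymTrans.ext (evalTrans_id (P := P.toPresentation) A p)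
  map_comp s t := SymTrans.ext (evalTrans_comp (P := P.toPresentation) A s t)

variable {P}

theorem eq_ofParam {A : SymOperad.{v, u}} (p : P.Param A) (G : P.free ⟶ A)
    (hgen : ∀ d, (G.functor (P.ar d)).obj (mkObj (P := P.toPresentation) (.gen d)) =
      (P.gen A d).obj p)
    (hcell : ∀ {n : OmegaMono} (j : P.Cell n),
      HEq ((G.functor n).map (homOfMor (Mor.cell (P := P.toPresentation) (T := n) j)))
        ((P.interp A j).app p)) :
    G = (P.ofParam A).obj p := by
  have h : G.toOpFunctor = evalOp (P := P.toPresentation) A p :=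
    eq_evalOp (P := P.toPresentation) A p G.toOpFunctor (fun {n} π => G.act n π) hgen hcell
  -- Commutation with the actions is a proposition, so equality of the underlying functors suffices.
  exact SymFunctor.ext (congrArg OpFunctor.functor h)

theorem symTrans_ext {A : SymOperad.{v, u}} {Φ Ψ : P.free ⟶ A} (α β : Φ ⟶ Ψ)
    (hgen : ∀ d, (α.app (P.ar d)).app (mkObj (P := P.toPresentation) (.gen d)) =
      (β.app (P.ar d)).app (mkObj (P := P.toPresentation) (.gen d))) : α = β := by
  refine SymTrans.ext (opTrans_ext (P := P.toPresentation) _ _ (fun {n} π X h => ?_) hgen)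
  refine (α.act n π X).trans (Eq.trans ?_ (β.act n π X).symm)
  rw [h]

theorem conj_app_app {A B : SymOperad.{v, u}} {Φ Φ' Ψ' Ψ : A ⟶ B} (h : Φ = Φ') (α : Φ' ⟶ Ψ')
    (h' : Ψ' = Ψ) {n : OmegaMono} (x : A.obj n)
    (g : (Φ.functor n).obj x ⟶ (Ψ.functor n).obj x) (hg : HEq g ((α.app n).app x)) :
    g = ((eqToHom h ≫ α ≫ eqToHom h').app n).app x := by
  subst h h'
  rw [eqToHom_refl, Category.id_comp, eqToHom_refl, Category.comp_id]
  exact eq_of_heq hg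

/-- The expression for the multiplication along an arbitrary map. -/
def mulTerm {D : Type} {ar : D → OmegaMono} {n k : OmegaS} (σ : n ⟶ k) {F : Fin k.size → OmegaS}
    (hF : Fibres σ F) (x : Term (fun n : OmegaMono => Equiv.Perm (Fin n.size)) ar k.mono)
    (y : ∀ i, Term (fun n : OmegaMono => Equiv.Perm (Fin n.size)) ar (F i).mono) :
    Term (fun n : OmegaMono => Equiv.Perm (Fin n.size)) ar n.mono :=
  Term.act (T := n.mono) (OmegaS.perm (tip σ))⁻¹
    (.mul (OmegaS.sorted σ) (OmegaS.sortedFibres hF) x y)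

/-- Multiplication along an arbitrary map is a product followed by a permutation; each is computed
on classes of expressions in turn. -/
theorem toSMul_mkObj {n k : OmegaS} (σ : n ⟶ k) {F : Fin k.size → OmegaS} (hF : Fibres σ F)
    (x : P.toPresentation.Expr k.mono) (y : ∀ i, P.toPresentation.Expr (F i).mono) :
    (P.free.toSMul σ hF).obj (mkObj x, fun i => mkObj (y i)) =
      mkObj (P := P.toPresentation) (mulTerm σ hF x y) :=
  (congrArg (permFunctor n.mono (OmegaS.perm (tip σ))⁻¹).obj
    (mulFunctor_mkObj (P := P.toPresentation) _ _ x y)).trans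
    (actFunctor_mkObj (P := P.toPresentation) (T := n.mono)
      (show Equiv.Perm (Fin n.size) from (OmegaS.perm (tip σ))⁻¹) _)

end SymPresentation

/-- The structure morphisms of an internal operad, indexed by an arity. -/
inductive ArityCell {D : Type} [FibreCat D] (ar : D → OmegaMono) : OmegaMono → Type
  | of {T : D} (j : OpCell D T) : ArityCell ar (ar T)

/-! ### The symmetric operads representing internal `n`-operads for finite `n` -/

namespace NTree

open Presentation SymPresentation

variable (n : ℕ)

/-- The presentation of the universal left symmetric categorical operad with an internal
`n`-operad. -/
def symPresentation : SymPresentation.{v, u, max v u} where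
  Gen := NTree n
  ar T := T.tips.mono
  Param A := InternalOperad (restrictObj n A.toSObj)
  gen A := InternalOperad.component (restrictObj n A.toSObj)
  Cell := ArityCell fun T : NTree n => T.tips.mono
  src j := match j with
    -- The source spells out the multiplication of the desymmetrisation, sorting permutation
    -- included. Its value is then definitionally the source of `mulTrans`, so `interp` needs no
    -- transport.
    | .of (.mul σ hF) => mulTerm (tipsHom σ) (tipsFibres hF) (.gen _) fun _ => .gen _
    | .of .unit => .unit
  tgt j := match j with
    | .of (T := T) _ => .gen T
  interp A _ j := match j with
    | .of (.mul σ hF) => InternalOperad.mulTrans (restrictObj n A.toSObj) σ hF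
    | .of .unit => InternalOperad.unitTrans (restrictObj n A.toSObj)

variable {n}

/-- The generators of the free operad. -/
noncomputable def symGen (T : NTree n) : (symPresentation.{v, u} n).Obj T.tips.mono :=
  mkObj (P := (symPresentation.{v, u} n).toPresentation) (.gen T)

noncomputable def symMul {T S : NTree n} (σ : T ⟶ S) {F : Fin (card S) → NTree n}
    (hF : Fibres σ F) :
    ((restrictObj n (symPresentation.{v, u} n).free.toSObj).mul σ hF).obj
      (symGen S, fun i => symGen (F i)) ⟶ symGen T :=
  eqToHom (toSMul_mkObj (P := symPresentation.{v, u} n) (tipsHom σ) (tipsFibres hF)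
    (.gen S) fun i => .gen (F i)) ≫
    homOfMor (Mor.cell (P := (symPresentation.{v, u} n).toPresentation) (T := T.tips.mono)
      (ArityCell.of (ar := fun T : NTree n => T.tips.mono) (OpCell.mul σ hF)))

noncomputable def symUnit :
    (restrictObj n (symPresentation.{v, u} n).free.toSObj).unit ⟶ symGen (pt : NTree n) :=
  homOfMor (Mor.cell (P := (symPresentation.{v, u} n).toPresentation) (T := pt)
    (ArityCell.of (ar := fun T : NTree n => T.tips.mono) (OpCell.unit (D := NTree n))))

section

variable (A : SymOperad.{v, u}) (a : InternalOperad (restrictObj n A.toSObj))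

theorem eval_symGen (T : NTree n) :
    (evalFunctor (P := (symPresentation n).toPresentation) A a T.tips.mono).obj (symGen T) =
      a.obj T :=
  evalFunctor_mkObj (P := (symPresentation n).toPresentation) A a _

theorem eval_symMul {T S : NTree n} (σ : T ⟶ S) {F : Fin (card S) → NTree n} (hF : Fibres σ F) :
    HEq ((evalFunctor (P := (symPresentation n).toPresentation) A a T.tips.mono).map (symMul σ hF))
      (a.mul σ hF) :=
  (map_eqToHom_comp_heq (evalFunctor (P := (symPresentation n).toPresentation) A a T.tips.mono)
    (toSMul_mkObj (P := symPresentation.{v, u} n) (tipsHom σ) (tipsFibres hF)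
      (.gen S) fun i => .gen (F i)) _).trans
    (evalFunctor_homOfMor_heq (P := (symPresentation n).toPresentation) A a
      (Mor.cell (P := (symPresentation.{v, u} n).toPresentation) (T := T.tips.mono)
        (ArityCell.of (ar := fun T : NTree n => T.tips.mono) (OpCell.mul σ hF))))

theorem eval_symUnit :
    HEq ((evalFunctor (P := (symPresentation n).toPresentation) A a pt).map symUnit) a.unit :=
  evalFunctor_homOfMor_heq (P := (symPresentation n).toPresentation) A a
    (Mor.cell (P := (symPresentation.{v, u} n).toPresentation) (T := pt)
      (ArityCell.of (ar := fun T : NTree n => T.tips.mono) (OpCell.unit (D := NTree n))))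

end

variable (n) in
/-- The universal internal `n`-operad in a left symmetric categorical operad. -/
noncomputable def symUniversal :
    InternalOperad (restrictObj n (symPresentation.{v, u} n).free.toSObj) :=
  InternalOperad.ofJointlyFaithful
    (I := Σ A : SymOperad.{v, u}, InternalOperad (restrictObj n A.toSObj))
    (fun i => restrictMap (SymOperad.toSMap (((symPresentation n).ofParam i.1).obj i.2)))
    -- Desymmetrisation keeps the underlying functors, so joint faithfulness is again that of the
    -- evaluations.
    (fun i => i.2) (fun _ _ h => hom_ext_evalOp fun b p => h ⟨b, p⟩)
    symGen symMul symUnit (fun i T => (eval_symGen i.1 i.2 T).symm)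
    (fun i _ _ σ _ hF => (eval_symMul i.1 i.2 σ hF).symm) (fun i => (eval_symUnit i.1 i.2).symm)

/-- Uniqueness again reduces to generators and generating morphisms; commutation with permutations
is already part of `Φ`. -/
theorem ofParam_map_symUniversal {A : SymOperad.{v, u}} (Φ : (symPresentation n).free ⟶ A) :
    ((symPresentation n).ofParam A).obj
      ((InternalOperad.map (restrictMap (SymOperad.toSMap Φ))).obj (symUniversal n)) = Φ := by
  refine (eq_ofParam _ Φ (fun _ => rfl) ?_).symm
  rintro m ⟨⟨σ, hF⟩ | _⟩
  · exact ((eqToHom_comp_heq _ _).trans (map_eqToHom_comp_heq (Φ.functor _) _ _)).symm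
  · exact (eqToHom_comp_heq ((Φ.functor pt).map symUnit) _).symm

theorem map_ofParam_symUniversal {A : SymOperad.{v, u}}
    (a : InternalOperad (restrictObj n A.toSObj)) :
    (InternalOperad.map (restrictMap (SymOperad.toSMap
      (((symPresentation n).ofParam A).obj a)))).obj (symUniversal n) = a :=
  InternalOperad.ext' (funext fun T => eval_symGen A a T)
    (fun σ _ hF => (eqToHom_comp_heq _ _).trans (eval_symMul A a σ hF))
    ((eqToHom_comp_heq _ _).trans (eval_symUnit A a))

variable (n) in
noncomputable def representsSym :
    Represents (IntOpSym (n : ℕ∞)) (symPresentation.{v, u} n).free :=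
  Represents.ofUniversal (IntOpSym (n : ℕ∞)) _ (symUniversal n)
    (fun A => (symPresentation n).ofParam A)
    (fun A => CategoryTheory.Functor.ext (fun Φ => ofParam_map_symUniversal Φ) fun Φ Ψ α => by
      refine symTrans_ext _ _ fun T => ?_
      exact SymPresentation.conj_app_app (ofParam_map_symUniversal Φ) α
        (ofParam_map_symUniversal Ψ).symm _ _
        (evalTrans_mkObj_heq (P := (symPresentation n).toPresentation) A _ (.gen T)))
    (fun A => InternalOperad.functor_ext (fun a => map_ofParam_symUniversal a)
      fun f T => evalTrans_mkObj_heq (P := (symPresentation n).toPresentation) A f (.gen T))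

end NTree

/-! ### The symmetric operad representing internal symmetric operads -/

namespace OmegaS

open Presentation SymPresentation

/-- The presentation of the universal left symmetric categorical operad with an internal symmetric
 operad. -/
def symPresentation : SymPresentation.{v, u, max v u} where
  Gen := OmegaS
  ar T := T.mono
  Param A := InternalOperad A.toSObj
  gen A := InternalOperad.component A.toSObj
  Cell := ArityCell fun T : OmegaS => T.mono
  src j := match j with
    | .of (.mul σ hF) => mulTerm σ hF (.gen _) fun _ => .gen _
    | .of .unit => .unit
  tgt j := match j with
    | .of (T := T) _ => .gen T
  interp A _ j := match j with
    | .of (.mul σ hF) => InternalOperad.mulTrans A.toSObj σ hF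
    | .of .unit => InternalOperad.unitTrans A.toSObj

/-- The generators of the free operad. -/
noncomputable def symGen (T : OmegaS) : symPresentation.{v, u}.Obj T.mono :=
  mkObj (P := symPresentation.{v, u}.toPresentation) (.gen T)

noncomputable def symMul {T S : OmegaS} (σ : T ⟶ S) {F : Fin (card S) → OmegaS}
    (hF : Fibres σ F) :
    (symPresentation.{v, u}.free.toSObj.mul σ hF).obj
      (symGen S, fun i => symGen (F i)) ⟶ symGen T :=
  eqToHom (toSMul_mkObj (P := symPresentation.{v, u}) σ hF
    (.gen S) fun i => .gen (F i)) ≫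
    homOfMor (Mor.cell (P := symPresentation.{v, u}.toPresentation) (T := T.mono)
      (ArityCell.of (ar := fun T : OmegaS => T.mono) (OpCell.mul σ hF)))

noncomputable def symUnit :
    symPresentation.{v, u}.free.toSObj.unit ⟶ symGen (pt : OmegaS) :=
  homOfMor (Mor.cell (P := symPresentation.{v, u}.toPresentation) (T := pt)
    (ArityCell.of (ar := fun T : OmegaS => T.mono) (OpCell.unit (D := OmegaS))))

section

variable (A : SymOperad.{v, u}) (a : InternalOperad A.toSObj)

theorem eval_symGen (T : OmegaS) :
    (evalFunctor (P := symPresentation.toPresentation) A a T.mono).obj (symGen T) =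
      a.obj T :=
  evalFunctor_mkObj (P := symPresentation.toPresentation) A a _

theorem eval_symMul {T S : OmegaS} (σ : T ⟶ S) {F : Fin (card S) → OmegaS} (hF : Fibres σ F) :
    HEq ((evalFunctor (P := symPresentation.toPresentation) A a T.mono).map (symMul σ hF))
      (a.mul σ hF) :=
  (map_eqToHom_comp_heq (evalFunctor (P := symPresentation.toPresentation) A a T.mono)
    (toSMul_mkObj (P := symPresentation.{v, u}) σ hF
      (.gen S) fun i => .gen (F i)) _).trans
    (evalFunctor_homOfMor_heq (P := symPresentation.toPresentation) A a
      (Mor.cell (P := symPresentation.{v, u}.toPresentation) (T := T.mono)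
        (ArityCell.of (ar := fun T : OmegaS => T.mono) (OpCell.mul σ hF))))

theorem eval_symUnit :
    HEq ((evalFunctor (P := symPresentation.toPresentation) A a pt).map symUnit) a.unit :=
  evalFunctor_homOfMor_heq (P := symPresentation.toPresentation) A a
    (Mor.cell (P := symPresentation.{v, u}.toPresentation) (T := pt)
      (ArityCell.of (ar := fun T : OmegaS => T.mono) (OpCell.unit (D := OmegaS))))

end

/-- The universal internal symmetric operad in a left symmetric categorical operad. -/
noncomputable def symUniversal :
    InternalOperad symPresentation.{v, u}.free.toSObj :=
  InternalOperad.ofJointlyFaithful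
    (I := Σ A : SymOperad.{v, u}, InternalOperad A.toSObj)
    (fun i => SymOperad.toSMap ((symPresentation.ofParam i.1).obj i.2))
    (fun i => i.2) (fun _ _ h => hom_ext_evalOp fun b p => h ⟨b, p⟩)
    symGen symMul symUnit (fun i T => (eval_symGen i.1 i.2 T).symm)
    (fun i _ _ σ _ hF => (eval_symMul i.1 i.2 σ hF).symm) (fun i => (eval_symUnit i.1 i.2).symm)

theorem ofParam_map_symUniversal {A : SymOperad.{v, u}} (Φ : symPresentation.free ⟶ A) :
    (symPresentation.ofParam A).obj
      ((InternalOperad.map (SymOperad.toSMap Φ)).obj symUniversal) = Φ := by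
  refine (eq_ofParam _ Φ (fun _ => rfl) ?_).symm
  rintro m ⟨⟨σ, hF⟩ | _⟩
  · exact ((eqToHom_comp_heq _ _).trans (map_eqToHom_comp_heq (Φ.functor _) _ _)).symm
  · exact (eqToHom_comp_heq ((Φ.functor pt).map symUnit) _).symm

theorem map_ofParam_symUniversal {A : SymOperad.{v, u}}
    (a : InternalOperad A.toSObj) :
    (InternalOperad.map (SymOperad.toSMap
      ((symPresentation.ofParam A).obj a))).obj symUniversal = a :=
  InternalOperad.ext' (funext fun T => eval_symGen A a T)
    (fun σ _ hF => (eqToHom_comp_heq _ _).trans (eval_symMul A a σ hF))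
    ((eqToHom_comp_heq _ _).trans (eval_symUnit A a))

noncomputable def representsSym :
    Represents (IntOpSym ⊤) symPresentation.{v, u}.free :=
  Represents.ofUniversal (IntOpSym ⊤) _ symUniversal
    (fun A => symPresentation.ofParam A)
    (fun A => CategoryTheory.Functor.ext (fun Φ => ofParam_map_symUniversal Φ) fun Φ Ψ α => by
      refine symTrans_ext _ _ fun T => ?_
      exact SymPresentation.conj_app_app (ofParam_map_symUniversal Φ) α
        (ofParam_map_symUniversal Ψ).symm _ _
        (evalTrans_mkObj_heq (P := symPresentation.toPresentation) A _ (.gen T)))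
    (fun A => InternalOperad.functor_ext (fun a => map_ofParam_symUniversal a)
      fun f T => evalTrans_mkObj_heq (P := symPresentation.toPresentation) A f (.gen T))

end OmegaS

/-! ### Left Kan extension along `ζ` from the adjunction -/

namespace Represents

open Bicategory

section

variable {B : Type*} [Bicategory B] [Bicategory.Strict B] {G : StrictPseudofunctor B Cat.{v, u}}
  {h : B} (r : Represents G h) {A : B}

theorem hom_map_injective {x y : h ⟶ A} {f g : x ⟶ y} (e : (r.hom A).map f = (r.hom A).map g) :
    f = g := by
  have hf := Functor.congr_hom (r.hom_inv A) f
  have hg := Functor.congr_hom (r.hom_inv A) g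
  simp only [Functor.comp_map, Functor.id_map] at hf hg
  rw [e, hg] at hf
  exact ((cancel_epi (eqToHom _)).1 ((cancel_mono (eqToHom _)).1
    ((Category.assoc _ _ _).trans (hf.trans (Category.assoc _ _ _).symm)))).symm

theorem hom_map_surjective {x y : h ⟶ A} (k : (r.hom A).obj x ⟶ (r.hom A).obj y) :
    ∃ f : x ⟶ y, (r.hom A).map f = k := by
  refine ⟨eqToHom (Functor.congr_obj (r.hom_inv A) x).symm ≫ (r.inv A).map k ≫
    eqToHom (Functor.congr_obj (r.hom_inv A) y), ?_⟩
  have hk := Functor.congr_hom (r.inv_hom A) k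
  simp only [Functor.comp_map, Functor.id_map] at hk
  rw [Functor.map_comp, Functor.map_comp, hk, eqToHom_map, eqToHom_map]
  simp

end

/-- Internal desymmetrisation is 2-natural: at a tree, each side is the component of `α` at the
object indexed by the tips. -/
theorem delta_map₂ (n : ℕ∞) {A D : SymOperad.{v, u}} {f g : A ⟶ D} (α : f ⟶ g)
    (x : (IntOpSym ⊤).obj A) :
    HEq (((IntOpSym n).map₂ α).toNatTrans.app ((delta n A).obj x))
      ((delta n D).map (((IntOpSym ⊤).map₂ α).toNatTrans.app x)) := by
  cases n <;> rfl

theorem map_heq_map {X Y : Type*} [Category* X] [Category* Y] (F : X ⥤ Y) {x y x' y' : X}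
    (hx : x = x') (hy : y = y') {f : x ⟶ y} {g : x' ⟶ y'} (e : HEq f g) :
    HEq (F.map f) (F.map g) := by
  subst hx hy
  cases e
  rfl

theorem eqToHom_conj_eq_iff {X : Type*} [Category* X] {x y x' y' : X} (hx : x = x') (hy : y' = y)
    (f : x' ⟶ y') (g : x ⟶ y) :
    eqToHom hx ≫ f ≫ eqToHom hy = g ↔ f = eqToHom hx.symm ≫ g ≫ eqToHom hy.symm := by
  subst hx hy
  simp

theorem app_heq_app {X Y : Type*} [Category* X] [Category* Y] {F F' : X ⥤ Y} (α : F ⟶ F')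
    {x y : X} (e : x = y) : HEq (α.app x) (α.app y) := by
  subst e
  rfl

theorem id_whiskerLeft_eq {A D : SymOperad.{v, u}} {f g : A ⟶ D} (α : f ⟶ g) : 𝟙 A ◁ α = α :=
  SymOperad.hom₂_ext fun _ => rfl

section

variable {n : ℕ∞} {h H : SymOperad.{v, u}} (rh : Represents (IntOpSym n) h)
  (rH : Represents (IntOpSym ⊤) H) {A : SymOperad.{v, u}}

/-- Whiskering with `ζ` corresponds to internal desymmetrisation. -/
theorem hom_zeta_whiskerLeft {x y : H ⟶ A} (α : x ⟶ y) :
    (rh.hom A).map (rh.zeta rH ◁ α) = eqToHom (rh.hom_zeta_comp rH x) ≫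
      (delta n A).map ((rH.hom A).map α) ≫ eqToHom (rh.hom_zeta_comp rH y).symm := by
  refine (conj_eqToHom_iff_heq _ _ (rh.hom_zeta_comp rH x) (rh.hom_zeta_comp rH y)).2 ?_
  have h1 := (conj_eqToHom_iff_heq _ _ (Functor.congr_obj (rh.naturality x) (rh.zeta rH))
    (Functor.congr_obj (rh.naturality y) (rh.zeta rH))).1 (rh.naturality₂ α (rh.zeta rH))
  have h2 := (conj_eqToHom_iff_heq _ _ (Functor.congr_obj (rH.naturality x) (𝟙 H))
    (Functor.congr_obj (rH.naturality y) (𝟙 H))).1 (rH.naturality₂ α (𝟙 H))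
  -- The element of `ζ` is the desymmetrised universal element, so whiskering with `ζ` evaluates `α`
  -- there. By 2-naturality this is the desymmetrisation of `α` evaluated at the universal element,
  -- and the latter is the image of `α` under `rH.hom`, by naturality at the identity of `H`.
  refine h1.trans ((app_heq_app _ (rh.hom_inv_obj _)).trans ((delta_map₂ n α _).trans ?_))
  rw [id_whiskerLeft_eq] at h2
  exact (map_heq_map (delta n A) (Functor.congr_obj (rH.naturality x) (𝟙 H))
    (Functor.congr_obj (rH.naturality y) (𝟙 H)) h2).symm

variable {sym : (IntOpSym n).obj A ⥤ (IntOpSym ⊤).obj A} (adj : sym ⊣ delta n A)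
  {a : (IntOpSym n).obj A}

/-- Pasting with the unit cell becomes composing the unit of the adjunction with a desymmetrised
morphism, which is the adjunct. -/
theorem hom_map_unit_comp {η : (rh.inv A).obj a ⟶ rh.zeta rH ≫ (rH.inv A).obj (sym.obj a)}
    (hη : (rh.hom A).map η = eqToHom (rh.hom_inv_obj a) ≫ adj.unit.app a ≫
      eqToHom (rh.hom_zeta_comp_inv rH (sym.obj a)).symm)
    {t : H ⟶ A} (β : (rH.inv A).obj (sym.obj a) ⟶ t) :
    (rh.hom A).map (η ≫ rh.zeta rH ◁ β) = eqToHom (rh.hom_inv_obj a) ≫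
      adj.homEquiv _ _ (eqToHom (rH.hom_inv_obj (sym.obj a)).symm ≫ (rH.hom A).map β) ≫
        eqToHom (rh.hom_zeta_comp rH t).symm := by
  rw [Functor.map_comp, hη, rh.hom_zeta_whiskerLeft rH, adj.homEquiv_unit, Functor.map_comp,
    eqToHom_map]
  simp only [Category.assoc, eqToHom_trans_assoc]

/-- The universal property of the left Kan extension along `ζ`. -/
theorem exists_unique_desc {η : (rh.inv A).obj a ⟶ rh.zeta rH ≫ (rH.inv A).obj (sym.obj a)}
    (hη : (rh.hom A).map η = eqToHom (rh.hom_inv_obj a) ≫ adj.unit.app a ≫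
      eqToHom (rh.hom_zeta_comp_inv rH (sym.obj a)).symm)
    {t : H ⟶ A} (θ : (rh.inv A).obj a ⟶ rh.zeta rH ≫ t) :
    ∃! β : (rH.inv A).obj (sym.obj a) ⟶ t, η ≫ rh.zeta rH ◁ β = θ := by
  -- The adjunct of the morphism of internal `n`-operads that corresponds to `θ` is the only
  -- candidate for the image of the factorisation.
  let β' := (adj.homEquiv _ _).symm (eqToHom (rh.hom_inv_obj a).symm ≫ (rh.hom A).map θ ≫
    eqToHom (rh.hom_zeta_comp rH t))
  have key : ∀ β : (rH.inv A).obj (sym.obj a) ⟶ t, η ≫ rh.zeta rH ◁ β = θ ↔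
      (rH.hom A).map β = eqToHom (rH.hom_inv_obj (sym.obj a)) ≫ β' := by
    intro β
    have h1 : η ≫ rh.zeta rH ◁ β = θ ↔ (rh.hom A).map (η ≫ rh.zeta rH ◁ β) = (rh.hom A).map θ :=
      ⟨congrArg _, rh.hom_map_injective⟩
    rw [h1, hom_map_unit_comp rh rH adj hη, eqToHom_conj_eq_iff, ← Equiv.eq_symm_apply]
    exact eqToHom_comp_iff (rH.hom_inv_obj (sym.obj a)).symm _ _
  -- Fullness of `rH.hom` yields the factorisation, and its faithfulness yields uniqueness.
  obtain ⟨β, hβ⟩ := rH.hom_map_surjective (eqToHom (rH.hom_inv_obj (sym.obj a)) ≫ β')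
  exact ⟨β, (key β).2 hβ, fun γ hγ => rH.hom_map_injective (((key γ).1 hγ).trans hβ.symm)⟩

end

end Represents

end HigherOperad

theorem mainTheorem4 :
    (∀ n : ℕ, 1 ≤ n → ∃ H : CatOperad.{v, u} (NTree n),
      Nonempty (Represents (IntOp (NTree n)) H)) ∧
    (∃ H : SymOperad.{v, u}, Nonempty (Represents (IntOpSym ⊤) H)) ∧
    (∀ n : ℕ∞, 1 ≤ n → ∃ h : SymOperad.{v, u}, Nonempty (Represents (IntOpSym n) h)) ∧
    (∀ n : ℕ∞, 1 ≤ n → ∀ (h H : SymOperad.{v, u}) (rh : Represents (IntOpSym n) h)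
      (rH : Represents (IntOpSym ⊤) H) (A : SymOperad.{v, u})
      (sym : (IntOpSym n).obj A ⥤ (IntOpSym ⊤).obj A) (adj : sym ⊣ delta n A) (a : (IntOpSym n).obj A),
      ∃ η : (rh.inv A).obj a ⟶ rh.zeta rH ≫ (rH.inv A).obj (sym.obj a),
        (rh.hom A).map η = eqToHom (rh.hom_inv_obj a) ≫ adj.unit.app a ≫
          eqToHom (rh.hom_zeta_comp_inv rH (sym.obj a)).symm ∧
        Nonempty (Bicategory.LeftExtension.mk _ η).IsKan) := by
  refine ⟨fun n _ => ⟨_, ⟨CatOperad.represents (NTree n)⟩⟩, ⟨_, ⟨OmegaS.representsSym⟩⟩,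
    fun n _ => ?_, fun n _ h H rh rH A sym adj a => ?_⟩
  · cases n with
    | top => exact ⟨_, ⟨OmegaS.representsSym⟩⟩
    | coe n => exact ⟨_, ⟨NTree.representsSym n⟩⟩
  -- The universal 2-cell is obtained by lifting the unit of the adjunction through the
  -- representation; the transports only identify its ends.
  · obtain ⟨η, hη⟩ := rh.hom_map_surjective (eqToHom (rh.hom_inv_obj a) ≫ adj.unit.app a ≫
      eqToHom (rh.hom_zeta_comp_inv rH (sym.obj a)).symm)
    refine ⟨η, hη, ⟨Bicategory.LeftExtension.IsKan.mk (fun s =>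
      Bicategory.LeftExtension.homMk (rh.exists_unique_desc rH adj hη s.hom).choose
        (rh.exists_unique_desc rH adj hη s.hom).choose_spec.1) fun s τ => ?_⟩⟩
    -- A morphism of left extensions is a 2-cell with the factorisation property, so uniqueness of
    -- that 2-cell makes the extension initial.
    exact StructuredArrow.hom_ext _ _ ((rh.exists_unique_desc rH adj hη s.hom).choose_spec.2 _
      (Bicategory.LeftExtension.w τ))
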